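/- Let $\mathcal V$ be the set of finite words over $\mathbf N=\{1,2,\dots\}$ with empty word $\phi$, and let $\mathcal T$ be the infinite tree on $\mathcal V$, rooted at $\phi$, in which each word $v$ is joined to the words $v.i$, $i\in\mathbf N$. Give the edge $\{v,v.i\}$ the length $\xi(v,v.i)=\xi(v.i,v)=\xi^v_i$, where $0<\xi^v_1<\xi^v_2<\cdots$, $v\in\mathcal V$, are the points of independent Poisson processes of rate $1$ on $\mathbf R_+$; with these lengths $\mathcal T$ is called the Poisson weighted infinite tree (PWIT). Let $W(1)\ge 0$ be the number with $W(1)e^{W(1)}=1$, and let $F_*$ be the law on $[0,\infty)$ with $F_*((y,\infty))=W(1)e^{-y}$ for $y\ge0$. A random edge cover of the PWIT is a random edge set $\mathcal C$, defined together with the lengths $\xi$ on some probability space (extra randomness is allowed), which almost surely covers every vertex. It is called involution invariant if $$\mathbf E\Big[\sum_{x\sim\phi} f(G,\phi,x)\Big]=\mathbf E\Big[\sum_{x\sim\phi} f(G,x,\phi)\Big],\qquad G=(\mathcal T,\xi,\mathbf 1_{\mathcal C}),$$ for every nonnegative Borel function $f$ of a network with an ordered pair of distinguished vertices that depends only on its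 isomorphism class. Write $\mathcal C(\phi)$ for the set of vertices adjacent to $\phi$ in $\mathcal C$. A stationary message process on the PWIT is a family of real random variables $X(u,v)$, one for each directed edge $(u,v)$ of $\mathcal T$, such that almost surely, for every directed edge $(u,v)$, $$X(u,v)=\min\big\{(\xi(v,w)-X(v,w))^+ : w\sim v,\ w\ne u\big\},$$ and such that for each $d\ge 0$ the variables $X(v,v.i)$ with $|v|=d$, $i\in\mathbf N$, are independent with law $F_*$ and jointly independent of the lengths of the edges $\{u,u.j\}$ with $|u|\le d$. Given such a process put $$\mathcal C_{\mathrm{opt}}(v)=\operatorname*{arg\,min}_{y\sim v}\,(\xi(v,y)-X(v,y))^+ ,\qquad \mathcal C_{\mathrm{opt}}=\bigcup_v\big\{\{v,w\}: w\in\mathcal C_{\mathrm{opt}}(v)\big\},$$ where the $\arg\min$ is the set of all minimizers. **Theorem.** A stationary message process on the PWIT exists. For every such process, the edge set $\mathcal C_{\mathrm{opt}}$ is an involution invariant edge cover of the PWIT, and it has the least expected cost at the root among all such covers: for every involution invariant edge cover $\mathcal C$ of the PWIT, $$\mathbf E\Big[\sum_{v\in\mathcal C(\phi)}\xi(\phi,v)\Big]\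 \ge\ \mathbf E\Big[\sum_{v:\,\{\phi,v\}\in\mathcal C_{\mathrm{opt}}}\xi(\phi,v)\Big],$$ where expectations take values in $[0,\infty]$. -/

import Mathlib

open MeasureTheory ProbabilityTheory
open scoped ENNReal

noncomputable section

namespace PWIT

/-! ### The tree and its weights -/

/-- Finite words over a countable alphabet, stored with the last letter at the head:
the root is `[]`, and `i :: v` is the word `v.i`, the `i`-th child of `v`
(letters are counted from `0`). -/
abbrev Word : Type := List ℕ

/-- The infinite tree in which every word `v` is joined to its children `i :: v`. -/
def tree : SimpleGraph Word where
  Adj u v := (∃ i, v = i :: u) ∨ (∃ i, u = i :: v)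
  symm := ⟨fun _ _ h => h.symm⟩
  loopless := ⟨fun u h => by
    rcases h with ⟨i, h⟩ | ⟨i, h⟩ <;> simpa using congrArg List.length h⟩

/-- Undirected edges of the tree. -/
abbrev Edge : Type := tree.edgeSet

/-- Directed edges of the tree: `d = (u, v)` has `d.fst = u` and `d.snd = v`. -/
abbrev DirEdge : Type := tree.Dart

theorem adj_child (v : Word) (i : ℕ) : tree.Adj v (i :: v) := Or.inl ⟨i, rfl⟩

/-- The directed edge `(v, v.i)`, which points away from the root. -/
def down (v : Word) (i : ℕ) : DirEdge := ⟨(v, i :: v), adj_child v i⟩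

/-- The undirected edge underlying a directed edge. -/
def und (d : DirEdge) : Edge := ⟨d.edge, d.edge_mem⟩

/-- The gaps `ξ^v_0, ξ^v_1 - ξ^v_0, ξ^v_2 - ξ^v_1, …` between the lengths of the successive
edges from `v` to its children. -/
def gap (ℓ : Edge → ℝ) (v : Word) : ℕ → ℝ
  | 0 => ℓ (und (down v 0))
  | i + 1 => ℓ (und (down v (i + 1))) - ℓ (und (down v i))

/-- `ξ` makes the tree a Poisson weighted infinite tree: the sequences `(ξ^v_i)_i`,
for the different vertices `v`, are the increasingly ordered points of independent Poisson
processes of rate one on the half line, that is, all gaps are independent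
exponential variables of mean one. -/
structure IsPWIT {Ω : Type*} [MeasurableSpace Ω] (P : Measure Ω) (ξ : Ω → Edge → ℝ) : Prop where
  measurable : Measurable ξ
  indep : iIndepFun (fun (p : Word × ℕ) ω => gap (ξ ω) p.1 p.2) P
  law : ∀ v i, P.map (fun ω => gap (ξ ω) v i) = expMeasure 1

/-! ### The stationary message process -/

/-- The Lambert function, the inverse of `x ↦ x * exp x` on the half line. -/
def lambertW : ℝ → ℝ := Function.invFunOn (fun x => x * Real.exp x) (Set.Ici 0)

/-- The complementary distribution function of the message law. -/
def messageTail (y : ℝ) : ℝ := if 0 ≤ y then lambertW 1 * Real.exp (-y) else 1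

/-- `(ξ(v,w) - X(v,w))⁺` for the directed edge `d = (v, w)`. -/
def reduced (ℓ : Edge → ℝ) (x : DirEdge → ℝ) (d : DirEdge) : ℝ := max (ℓ (und d) - x d) 0

/-- `(ξ, X)` is a PWIT with its stationary message process:
almost surely `X(u,v)` is the minimum of `(ξ(v,w) - X(v,w))⁺` over the neighbours `w ≠ u` of `v`,
for every directed edge `(u,v)`; and, for every `d`, the messages on the edges directed from
depth `d` to depth `d + 1` are independent, have the law with tail `messageTail`, and are jointly
independent of the lengths of the edges up to depth `d + 1`. -/
structure IsMessageProcess {Ω : Type*} [MeasurableSpace Ω] (P : Measure Ω)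
    (ξ : Ω → Edge → ℝ) (X : Ω → DirEdge → ℝ) : Prop where
  pwit : IsPWIT P ξ
  measurable : Measurable X
  recursion : ∀ᵐ ω ∂P, ∀ d : DirEdge,
    IsLeast (reduced (ξ ω) (X ω) '' {d' | d'.fst = d.snd ∧ d'.snd ≠ d.fst}) (X ω d)
  law : ∀ v i y, P {ω | y < X ω (down v i)} = ENNReal.ofReal (messageTail y)
  indep_level : ∀ d : ℕ,
    iIndepFun (fun (p : {v : Word // v.length = d} × ℕ) ω => X ω (down p.1 p.2)) P
  indep_lengths : ∀ d : ℕ,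
    IndepFun (fun ω (p : {v : Word // v.length = d} × ℕ) => X ω (down p.1 p.2))
      (fun ω (p : {v : Word // v.length ≤ d} × ℕ) => ξ ω (und (down p.1 p.2))) P

/-! ### Edge covers -/

/-- The edge set `c` covers every vertex. -/
def Covers (c : Set Edge) : Prop := ∀ v : Word, ∃ d : DirEdge, d.fst = v ∧ und d ∈ c

/-- A nonnegative Borel function `f (G, o, x)` of a network `G = (ℓ, c)` on the tree (edge lengths
`ℓ`, and the mark `e ↦ 1_{e ∈ c}` on the edges) with an ordered pair `(o, x)` of distinguished
vertices, which takes the same value on isomorphic networks. -/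
structure IsNetworkFunction (f : (Edge → ℝ) → Set Edge → Word → Word → ℝ≥0∞) : Prop where
  measurable : ∀ o x, Measurable fun p : (Edge → ℝ) × Set Edge => f p.1 p.2 o x
  iso : ∀ (γ : tree ≃g tree) (ℓ ℓ' : Edge → ℝ) (c c' : Set Edge),
    (∀ e, ℓ' (γ.mapEdgeSet e) = ℓ e) → (∀ e, γ.mapEdgeSet e ∈ c' ↔ e ∈ c) →
    ∀ o x, f ℓ' c' (γ o) (γ x) = f ℓ c o x

/-- `C` is a random edge cover of the PWIT `(tree, ξ)`, defined on the same probability space,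
and the law of the network `(tree, ξ, 1_C)` rooted at `[]` is involution invariant:
the expectations of the sums of `f(G, o, x)` and of `f(G, x, o)` over the neighbours `x` of the
root `o` agree for every nonnegative Borel function `f`. -/
structure IsInvolutionInvariantEdgeCover {Ω : Type*} [MeasurableSpace Ω] (P : Measure Ω)
    (ξ : Ω → Edge → ℝ) (C : Ω → Set Edge) : Prop where
  pwit : IsPWIT P ξ
  measurable : Measurable C
  covers : ∀ᵐ ω ∂P, Covers (C ω)
  involution : ∀ f : (Edge → ℝ) → Set Edge → Word → Word → ℝ≥0∞, IsNetworkFunction f →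
    ∫⁻ ω, ∑' x : tree.neighborSet [], f (ξ ω) (C ω) [] x ∂P =
      ∫⁻ ω, ∑' x : tree.neighborSet [], f (ξ ω) (C ω) x [] ∂P

/-- `E[∑_{v ∈ C(φ)} ξ(φ, v)]`, where `φ` is the root and `C(φ)` is the set of the vertices
adjacent to `φ` in `C`. -/
def expectedRootCost {Ω : Type*} [MeasurableSpace Ω] (P : Measure Ω)
    (ξ : Ω → Edge → ℝ) (C : Ω → Set Edge) : ℝ≥0∞ :=
  ∫⁻ ω, ∑' d : {d : DirEdge // d.fst = [] ∧ und d ∈ C ω}, ENNReal.ofReal (ξ ω (und d)) ∂P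

/-- The set of the vertices `w` for which `(ξ(v,·) - X(v,·))⁺` is minimal among the
neighbours of `v`. -/
def optChoice (ℓ : Edge → ℝ) (x : DirEdge → ℝ) (v : Word) : Set Word :=
  {w | ∃ d : DirEdge, d.fst = v ∧ d.snd = w ∧
    ∀ d' : DirEdge, d'.fst = v → reduced ℓ x d ≤ reduced ℓ x d'}

/-- The edge set consisting of all `{v, w}` with `w ∈ optChoice v`. -/
def optCover (ℓ : Edge → ℝ) (x : DirEdge → ℝ) : Set Edge :=
  {e | ∃ d : DirEdge, d.snd ∈ optChoice ℓ x d.fst ∧ und d = e}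

end PWIT

end

/-!
The message recursion on the PWIT has, for almost all edge lengths, exactly one solution, and this
solution is a function of the lengths alone. One step of the recursion reverses the order of
messages, so, of the iterates started from zero, the even ones increase to a limit `lower`, the
odd ones decrease to a limit `upper`, and every solution lies in between
(`IsSolution.lower_le_and_le_upper`). On an edge directed away from the root, an iterate is computed
from a Poisson process on the half line, marked by the independent previous iterates in the subtrees
of the children. The void probabilities of marked Poisson processes (`measure_forall_notMem`) show
that a message computed from independent messages of mean `m` has the tail `exp (-m) * exp (-y)`,
hence the mean `exp (-m)` (`lintegral_shiftedMin`). Since `x ↦ exp (-x)` contracts `[exp (-1), 1]`,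
which contains all its iterates except the starting value zero, `lower` and `upper` have the same
finite mean, and therefore agree almost surely on the edges directed away from the root; the
recursion carries the equality over to all edges (`LocallyFinite.lower_eq_upper`). So a stationary
message process has to be `upper ξ` (`IsPWIT.ae_isSolution_iff`). Conversely `upper ξ` is one
(`isMessageProcess_upper`): the mean of its law is the fixed point of `x ↦ exp (-x)`, which is
`W(1)`.

Involution invariance of the optimal cover is inherited from the lengths, because `upper` and the
cover commute with automorphisms of the tree. The lengths are involution invariant by Mecke's
formula (`lintegral_tsum_pos_remove`): a PWIT with a distinguished edge at the root is a pair of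
independent PWITs whose roots are joined by an edge with a length distributed according to Lebesgue
measure, and the two trees may be exchanged (`lintegral_gapLaw_involution`).

For optimality, the length of every edge is split into two shares `share d + share d.symm`, which
depend on the lengths only. In an involution invariant cover, the expected cost at the root is twice
the expected cost of the shares charged to the root
(`IsInvolutionInvariantEdgeCover.expectedRootCost_eq`). So it suffices to compare the shares charged
to the root, and there the optimal cover is best for almost every realization of the lengths
(`rootShare_optCover_le`). With `z i = ξ(φ,i) - X(φ,i)`, the message `X(i,φ)` is the minimum of the
positive parts of the other `z j`, and the share of the root in the edge to `i` is
`(z i + X(i,φ)) / 2`, truncated to the interval `[0, ξ(φ,i)]`. The edge to `i` belongs to the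
optimal cover if and only if `z i ≤ X(i,φ)`. If such an edge has a positive share at the root, then
`X(i,φ)` is positive, so that `z i` is the smallest and `X(i,φ)` the second smallest of the `z j`.
In the absence of ties this is the only edge of the optimal cover at the root, and any other edge
has a share at least as large, while a cover has to use some edge at the root. If no edge of the
optimal cover has a positive share at the root, then the root is not charged at all.
-/

noncomputable section

namespace PWIT

/-! ### Poisson processes with independent marks -/

instance : IsProbabilityMeasure (expMeasure 1) := isProbabilityMeasure_expMeasure one_pos

theorem lintegral_expMeasure_one {f : ℝ → ℝ≥0∞} (hf : Measurable f) :
    ∫⁻ a, f a ∂expMeasure 1 = ∫⁻ a in Set.Ici 0, ENNReal.ofReal (Real.exp (-a)) * f a := by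
  have hpdf : Measurable (gammaPDF 1 1) := (measurable_gammaPDFReal 1 1).ennreal_ofReal
  rw [expMeasure, gammaMeasure, lintegral_withDensity_eq_lintegral_mul _ hpdf hf,
    ← lintegral_indicator measurableSet_Ici]
  refine lintegral_congr fun a => ?_
  have h := exponentialPDF_eq 1 a
  rw [exponentialPDF, exponentialPDFReal] at h
  simp only [Pi.mul_apply, gammaPDF, h, Set.indicator, Set.mem_Ici]
  split_ifs <;> simp

theorem ae_nonneg_expMeasure_one : ∀ᵐ a ∂expMeasure 1, 0 ≤ a := by
  have h : expMeasure 1 (Set.Iio 0) = 0 := by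
    rw [← lintegral_indicator_one measurableSet_Iio,
      lintegral_expMeasure_one (measurable_one.indicator measurableSet_Iio),
      setLIntegral_congr_fun (g := fun _ => 0) measurableSet_Ici]
    · simp
    · intro a ha
      simp [Set.indicator, not_lt.2 (Set.mem_Ici.1 ha)]
  rw [ae_iff]
  simpa [Set.Iio] using h

/-- The sequence with first term `a` and tail `s`. -/
def consSeq {α : Type*} (a : α) (s : ℕ → α) : ℕ → α
  | 0 => a
  | n + 1 => s n

theorem measurable_consSeq {α : Type*} [MeasurableSpace α] :
    Measurable fun p : α × (ℕ → α) => consSeq p.1 p.2 := by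
  refine measurable_pi_lambda _ fun n => ?_
  cases n with
  | zero => exact measurable_fst
  | succ n => exact (measurable_pi_apply n).comp measurable_snd

@[fun_prop]
theorem Measurable.consSeq {β α : Type*} [MeasurableSpace α] [MeasurableSpace β] {f : β → α}
    {g : β → ℕ → α} (hf : Measurable f) (hg : Measurable g) :
    Measurable fun b => consSeq (f b) (g b) :=
  measurable_consSeq.comp (hf.prodMk hg)

/-- A sequence of independent variables is its first term followed by an independent copy. -/
theorem infinitePi_nat_eq_map_consSeq {α : Type*} [MeasurableSpace α] (ρ : Measure α)
    [IsProbabilityMeasure ρ] :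
    Measure.infinitePi (fun _ : ℕ => ρ) =
      (ρ.prod (Measure.infinitePi fun _ : ℕ => ρ)).map fun p => consSeq p.1 p.2 := by
  classical
  symm
  refine Measure.eq_infinitePi _ fun F t ht => ?_
  obtain ⟨n, hn⟩ : ∃ n, F ⊆ Finset.range (n + 1) :=
    ⟨F.sup id, fun i hi => Finset.mem_range.2 (Nat.lt_succ_of_le (Finset.le_sup (f := id) hi))⟩
  set t' : ℕ → Set α := fun i => if i ∈ F then t i else Set.univ with ht'
  have ht'm : ∀ i, MeasurableSet (t' i) := fun i => by
    simp only [ht']; split_ifs; exacts [ht i, MeasurableSet.univ]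
  have hprod : ∏ i ∈ F, ρ (t i) = ∏ i ∈ Finset.range (n + 1), ρ (t' i) := by
    rw [← Finset.prod_subset hn (f := fun i => ρ (t' i))]
    · exact Finset.prod_congr rfl fun i hi => by simp [ht', hi]
    · intro i _ hi; simp [ht', hi]
  have hset : (F : Set ℕ).pi t = ((Finset.range (n + 1) : Finset ℕ) : Set ℕ).pi t' := by
    ext s
    simp only [Set.mem_pi, ht', Finset.mem_coe]
    constructor
    · intro h i _
      split_ifs with hi
      exacts [h i hi, trivial]
    · intro h i hi
      simpa [hi] using h i (hn hi)
  have hpre : (fun p : α × (ℕ → α) => consSeq p.1 p.2) ⁻¹'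
      (((Finset.range (n + 1) : Finset ℕ) : Set ℕ).pi t') =
      t' 0 ×ˢ (((Finset.range n : Finset ℕ) : Set ℕ).pi fun i => t' (i + 1)) := by
    ext p
    simp only [Set.mem_preimage, Set.mem_pi, Finset.mem_coe, Finset.mem_range, Set.mem_prod]
    constructor
    · intro h
      exact ⟨h 0 (by omega), fun i hi => h (i + 1) (by omega)⟩
    · rintro ⟨h0, h⟩ i hi
      cases i with
      | zero => exact h0
      | succ i => exact h i (by omega)
  rw [hprod, hset, Measure.map_apply measurable_consSeq
    (MeasurableSet.pi (Finset.countable_toSet _) fun i _ => ht'm i), hpre, Measure.prod_prod,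
    Measure.infinitePi_pi _ fun i _ => ht'm _, Finset.prod_range_succ', mul_comm]

section MarkedGaps

variable {S : Type*}

/-- The sum of the first `n` gaps of a sequence `s` of pairs, each consisting of the gap in front of
a point on the half line and of the mark of that point. -/
def arrival (s : ℕ → ℝ × S) (n : ℕ) : ℝ := ∑ j ∈ Finset.range n, (s j).1

/-- The position of the `i`-th point. -/
def pos (s : ℕ → ℝ × S) (i : ℕ) : ℝ := arrival s (i + 1)

/-- The increasing enumeration, by `j`, of the natural numbers other than `i`. -/
def skip (i j : ℕ) : ℕ := if j < i then j else j + 1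

/-- The marked gap sequence that is left when the `i`-th point is deleted: the two gaps next to this
point are added, and its mark is dropped. -/
def remove : ℕ → (ℕ → ℝ × S) → ℕ → ℝ × S
  | 0, s => consSeq ((s 0).1 + (s 1).1, (s 1).2) fun n => s (n + 2)
  | i + 1, s => consSeq (s 0) (remove i fun n => s (n + 1))

theorem arrival_consSeq (p : ℝ × S) (s : ℕ → ℝ × S) (n : ℕ) :
    arrival (consSeq p s) (n + 1) = p.1 + arrival s n := by
  simp [arrival, Finset.sum_range_succ', consSeq, add_comm]

theorem consSeq_zero_tail {α : Type*} (s : ℕ → α) : consSeq (s 0) (fun n => s (n + 1)) = s := by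
  funext n; cases n <;> rfl

theorem arrival_succ' (s : ℕ → ℝ × S) (n : ℕ) :
    arrival s (n + 1) = (s 0).1 + arrival (fun n => s (n + 1)) n := by
  rw [← arrival_consSeq, consSeq_zero_tail]

theorem skip_ne (i j : ℕ) : skip i j ≠ i := by unfold skip; split_ifs <;> omega

theorem skip_zero (j : ℕ) : skip 0 j = j + 1 := by simp [skip]

theorem skip_succ_zero (i : ℕ) : skip (i + 1) 0 = 0 := by simp [skip]

theorem skip_succ_succ (i j : ℕ) : skip (i + 1) (j + 1) = skip i j + 1 := by
  unfold skip; split_ifs <;> omega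

theorem pos_remove (i : ℕ) (s : ℕ → ℝ × S) (j : ℕ) : pos (remove i s) j = pos s (skip i j) := by
  unfold pos
  induction i generalizing s j with
  | zero =>
    rw [remove, arrival_consSeq, skip_zero, arrival_succ', arrival_succ']
    simp [add_assoc]
  | succ i ih =>
    rw [remove, arrival_consSeq]
    cases j with
    | zero => simp [skip_succ_zero, arrival]
    | succ j => rw [ih, skip_succ_succ, arrival_succ' s]

theorem remove_snd (i : ℕ) (s : ℕ → ℝ × S) (j : ℕ) : (remove i s j).2 = (s (skip i j)).2 := by
  induction i generalizing s j with
  | zero => rw [skip_zero]; cases j <;> rfl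
  | succ i ih =>
    cases j with
    | zero => rw [skip_succ_zero]; rfl
    | succ j => rw [skip_succ_succ]; exact ih _ _

variable [MeasurableSpace S]

/-- The law of the gaps between the successive points of a Poisson process of rate one on the half
line, paired with independent marks of law `ν` on the points. -/
def markedLaw (ν : Measure S) : Measure (ℕ → ℝ × S) :=
  Measure.infinitePi fun _ => (expMeasure 1).prod ν

instance (ν : Measure S) [IsProbabilityMeasure ν] : IsProbabilityMeasure (markedLaw ν) := by
  unfold markedLaw; infer_instance

@[fun_prop]
theorem measurable_arrival (n : ℕ) : Measurable fun s : ℕ → ℝ × S => arrival s n := by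
  unfold arrival; fun_prop

@[fun_prop]
theorem measurable_pos (n : ℕ) : Measurable fun s : ℕ → ℝ × S => pos s n :=
  measurable_arrival _

@[fun_prop]
theorem measurable_remove (i : ℕ) : Measurable (remove (S := S) i) := by
  induction i with
  | zero =>
    change Measurable fun s : ℕ → ℝ × S =>
      consSeq ((s 0).1 + (s 1).1, (s 1).2) fun n => s (n + 2)
    fun_prop
  | succ i ih =>
    have : Measurable fun s : ℕ → ℝ × S => remove i fun n => s (n + 1) :=
      ih.comp (by fun_prop)
    exact Measurable.consSeq (by fun_prop) this

variable (ν : Measure S) [IsProbabilityMeasure ν]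

theorem lintegral_markedLaw_eq_iterated {G : (ℕ → ℝ × S) → ℝ≥0∞} (hG : Measurable G) :
    ∫⁻ s, G s ∂markedLaw ν =
      ∫⁻ a, ∫⁻ y, ∫⁻ s, G (consSeq (a, y) s) ∂markedLaw ν ∂ν ∂expMeasure 1 := by
  have h : Measurable fun p : (ℝ × S) × (ℕ → ℝ × S) => G (consSeq p.1 p.2) :=
    hG.comp measurable_consSeq
  conv_lhs => rw [markedLaw, infinitePi_nat_eq_map_consSeq, ← markedLaw,
    lintegral_map hG measurable_consSeq, lintegral_prod _ h.aemeasurable,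
    lintegral_prod _ h.lintegral_prod_right'.aemeasurable]

theorem lintegral_markedLaw {G : (ℕ → ℝ × S) → ℝ≥0∞} (hG : Measurable G) :
    ∫⁻ s, G s ∂markedLaw ν =
      ∫⁻ a, ∫⁻ p, G (consSeq (a, p.1) p.2) ∂ν.prod (markedLaw ν) ∂expMeasure 1 := by
  rw [lintegral_markedLaw_eq_iterated ν hG]
  refine lintegral_congr fun a => ?_
  have h : Measurable fun p : S × (ℕ → ℝ × S) => G (consSeq (a, p.1) p.2) := by fun_prop
  rw [lintegral_prod _ h.aemeasurable]

/-- If `a` and `b` are independent exponential variables, then the pair `(a, a + b)` has the law of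
`(t, c)`, where `c` is exponential and `t` ranges over `[0, c)` with Lebesgue measure. -/
theorem lintegral_exp_exp {ψ : ℝ → ℝ → ℝ≥0∞} (hψ : Measurable (Function.uncurry ψ)) :
    ∫⁻ a, ∫⁻ b, ψ a (a + b) ∂expMeasure 1 ∂expMeasure 1 =
      ∫⁻ c, ∫⁻ t, (Set.Ico 0 c).indicator (fun t => ψ t c) t ∂volume ∂expMeasure 1 := by
  have hψ' : ∀ {f g : ℝ × ℝ → ℝ}, Measurable f → Measurable g →
      Measurable fun x => ψ (f x) (g x) := fun hf hg => hψ.comp (hf.prodMk hg)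
  have h2 : Measurable fun p : ℝ × ℝ => (Set.Ico 0 p.1).indicator (fun t => ψ t p.1) p.2 := by
    have hs : MeasurableSet {p : ℝ × ℝ | 0 ≤ p.2 ∧ p.2 < p.1} :=
      (measurableSet_le measurable_const measurable_snd).inter
        (measurableSet_lt measurable_snd measurable_fst)
    exact (hψ' (f := fun p => p.2) (g := fun p => p.1) measurable_snd measurable_fst).indicator hs
  conv_rhs => rw [lintegral_lintegral_swap h2.aemeasurable]
  rw [lintegral_expMeasure_one (Measurable.lintegral_prod_right' (f := fun p : ℝ × ℝ =>
    ψ p.1 (p.1 + p.2)) (hψ' (f := fun p => p.1)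
    (g := fun p => p.1 + p.2) (by fun_prop) (by fun_prop))),
    ← lintegral_indicator measurableSet_Ici]
  refine lintegral_congr fun t => ?_
  simp only [Set.indicator, Set.mem_Ici, Set.mem_Ico]
  split_ifs with ht
  swap
  · simp [ht]
  have hm : Measurable fun b => ψ t b := hψ.comp measurable_prodMk_left
  have hm2 : Measurable fun b => ψ t (t + b) :=
    hψ.comp (measurable_const.prodMk (measurable_const_add t))
  have hm3 : Measurable fun c => if 0 ≤ t ∧ t < c then ψ t c else 0 :=
    Measurable.ite (by simp only [ht, true_and]; exact measurableSet_Ioi) hm measurable_const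
  rw [lintegral_expMeasure_one hm2, lintegral_expMeasure_one hm3,
    ← lintegral_const_mul _ (by fun_prop), ← lintegral_indicator measurableSet_Ici,
    ← lintegral_indicator measurableSet_Ici]
  conv_rhs => rw [← lintegral_add_left_eq_self _ t]
  refine lintegral_congr_ae ?_
  filter_upwards [compl_mem_ae_iff.2 (measure_singleton (0 : ℝ))] with b hb
  have hb : b ≠ 0 := hb
  simp only [Set.indicator, Set.mem_Ici]
  rcases lt_or_gt_of_ne hb with h | h
  · simp only [not_le.2 h, not_lt.2 h.le, if_false, lt_add_iff_pos_right, and_false, mul_zero,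
      ite_self]
  · simp only [h.le, add_nonneg ht h.le, if_true, ht, true_and, lt_add_iff_pos_right, h]
    rw [← mul_assoc, ← ENNReal.ofReal_mul (Real.exp_nonneg _), ← Real.exp_add, neg_add]

/-- The contribution of the `i`-th point to Mecke's formula: the extra point falls between the point
of rank `i - 1` (or the origin, if `i = 0`) and the point of rank `i` of the remaining process. -/
theorem lintegral_pos_remove (i : ℕ) {H : ℝ × S × (ℕ → ℝ × S) → ℝ≥0∞} (hH : Measurable H) :
    ∫⁻ s, H (pos s i, (s i).2, remove i s) ∂markedLaw ν =
      ∫⁻ s, ∫⁻ t, (Set.Ico (arrival s i) (arrival s (i + 1))).indicator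
        (fun t => ∫⁻ x, H (t, x, s) ∂ν) t ∂volume ∂markedLaw ν := by
  have hmeas : ∀ (i : ℕ) {H : ℝ × S × (ℕ → ℝ × S) → ℝ≥0∞}, Measurable H →
      Measurable fun p : (ℕ → ℝ × S) × ℝ => (Set.Ico (arrival p.1 i)
        (arrival p.1 (i + 1))).indicator (fun t => ∫⁻ x, H (t, x, p.1) ∂ν) p.2 := by
    intro i H hH
    have h1 : Measurable fun p : (ℕ → ℝ × S) × ℝ => ∫⁻ x, H (p.2, x, p.1) ∂ν :=
      Measurable.lintegral_prod_right' (f := fun q : ((ℕ → ℝ × S) × ℝ) × S =>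
        H (q.1.2, q.2, q.1.1)) (hH.comp (by fun_prop))
    have hs : MeasurableSet {p : (ℕ → ℝ × S) × ℝ | arrival p.1 i ≤ p.2 ∧
        p.2 < arrival p.1 (i + 1)} := by measurability
    exact h1.indicator hs
  have hmeas' : ∀ (i : ℕ) {H : ℝ × S × (ℕ → ℝ × S) → ℝ≥0∞}, Measurable H →
      Measurable fun s : ℕ → ℝ × S => ∫⁻ t, (Set.Ico (arrival s i)
        (arrival s (i + 1))).indicator (fun t => ∫⁻ x, H (t, x, s) ∂ν) t ∂volume := fun i H hH =>
    Measurable.lintegral_prod_right' (hmeas i hH)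
  induction i generalizing H with
  | zero =>
    set ψ : ℝ → ℝ → ℝ≥0∞ := fun t c =>
      ∫⁻ x, ∫⁻ p, H (t, x, consSeq (c, p.1) p.2) ∂ν.prod (markedLaw ν) ∂ν with hψ
    have hψm : Measurable (Function.uncurry ψ) := by
      refine Measurable.lintegral_prod_right' (f := fun q : (ℝ × ℝ) × S =>
        ∫⁻ p, H (q.1.1, q.2, consSeq (q.1.2, p.1) p.2) ∂ν.prod (markedLaw ν)) ?_
      exact Measurable.lintegral_prod_right' (f := fun q : ((ℝ × ℝ) × S) × (S × (ℕ → ℝ × S)) =>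
        H (q.1.1.1, q.1.2, consSeq (q.1.1.2, q.2.1) q.2.2)) (hH.comp (by fun_prop))
    have hL : Measurable fun s : ℕ → ℝ × S => H (pos s 0, (s 0).2, remove 0 s) := by fun_prop
    rw [lintegral_markedLaw_eq_iterated ν hL, lintegral_markedLaw ν (hmeas' 0 hH)]
    trans ∫⁻ a, ∫⁻ b, ψ a (a + b) ∂expMeasure 1 ∂expMeasure 1
    · refine lintegral_congr fun a => ?_
      rw [hψ, lintegral_lintegral_swap (μ := expMeasure 1) (ν := ν)]
      · refine lintegral_congr fun x => ?_
        have hL' : Measurable fun s => H (pos (consSeq (a, x) s) 0, (consSeq (a, x) s 0).2,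
          remove 0 (consSeq (a, x) s)) := by fun_prop
        rw [lintegral_markedLaw ν hL']
        simp [pos, arrival, consSeq, remove]
      · exact (Measurable.lintegral_prod_right' (f := fun q : (ℝ × S) × (S × (ℕ → ℝ × S)) =>
          H (a, q.1.2, consSeq (a + q.1.1, q.2.1) q.2.2))
          (hH.comp (by fun_prop))).aemeasurable
    rw [lintegral_exp_exp hψm]
    refine lintegral_congr fun c => ?_
    rw [lintegral_lintegral_swap]
    · refine lintegral_congr fun t => ?_
      simp only [arrival, Finset.range_zero, Finset.sum_empty, zero_add, Finset.range_one,
        Finset.sum_singleton, consSeq, Set.indicator]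
      split_ifs with h
      · rw [hψ, lintegral_lintegral_swap]
        exact (hH.comp (by fun_prop)).aemeasurable
      · simp
    · exact ((hmeas 0 hH).comp (f := fun p : (S × (ℕ → ℝ × S)) × ℝ =>
        (consSeq (c, p.1.1) p.1.2, p.2)) (by fun_prop)).aemeasurable
  | succ i ih =>
    have hL : Measurable fun s : ℕ → ℝ × S =>
      H (pos s (i + 1), (s (i + 1)).2, remove (i + 1) s) := by fun_prop
    rw [lintegral_markedLaw_eq_iterated ν hL,
      lintegral_markedLaw_eq_iterated ν (hmeas' (i + 1) hH)]
    refine lintegral_congr fun a => lintegral_congr fun y => ?_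
    have := ih (H := fun p => H (a + p.1, p.2.1, consSeq (a, y) p.2.2)) (hH.comp (by fun_prop))
    simp only [pos, arrival_consSeq, consSeq, remove] at this ⊢
    rw [this]
    refine lintegral_congr fun s => ?_
    conv_rhs => rw [← lintegral_add_left_eq_self _ a]
    refine lintegral_congr fun t => ?_
    simp [Set.indicator]

theorem ae_gap_nonneg : ∀ᵐ s ∂markedLaw ν, ∀ i, 0 ≤ (s i).1 := by
  rw [ae_all_iff]
  intro i
  have h := Measure.infinitePi_map_eval (fun _ : ℕ => (expMeasure 1).prod ν) i
  have h1 : ∀ᵐ p ∂(expMeasure 1).prod ν, 0 ≤ p.1 :=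
    Measure.quasiMeasurePreserving_fst.ae ae_nonneg_expMeasure_one
  rw [← h] at h1
  exact ae_of_ae_map (measurable_pi_apply i).aemeasurable h1

theorem lintegral_exp_neg_expMeasure_one :
    ∫⁻ a, ENNReal.ofReal (Real.exp (-a)) ∂expMeasure 1 = 2⁻¹ := by
  rw [lintegral_expMeasure_one (by fun_prop), ← lintegral_indicator measurableSet_Ici,
    ← mul_one 2⁻¹, ← lintegral_exponentialPDF_eq_one (r := 2) two_pos,
    ← lintegral_const_mul _ (by exact (measurable_gammaPDFReal 1 2).ennreal_ofReal)]
  refine lintegral_congr fun a => ?_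
  simp only [exponentialPDF_eq, Set.indicator, Set.mem_Ici]
  split_ifs
  · rw [← ENNReal.ofReal_mul (Real.exp_nonneg _), ← Real.exp_add, ENNReal.ofReal_mul two_pos.le,
      ← mul_assoc, ENNReal.ofReal_ofNat, ENNReal.inv_mul_cancel two_ne_zero ENNReal.ofNat_ne_top,
      one_mul]
    ring_nf
  · simp

theorem lintegral_exp_neg_arrival (n : ℕ) :
    ∫⁻ s, ENNReal.ofReal (Real.exp (-arrival s n)) ∂markedLaw ν = 2⁻¹ ^ n := by
  induction n with
  | zero => simp [arrival]
  | succ n ih =>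
    rw [lintegral_markedLaw_eq_iterated ν (by fun_prop), pow_succ', ← ih,
      ← lintegral_exp_neg_expMeasure_one, ← lintegral_mul_const _ (by fun_prop)]
    refine lintegral_congr fun a => ?_
    simp only [arrival_consSeq, neg_add, Real.exp_add, ENNReal.ofReal_mul (Real.exp_nonneg _)]
    simp_rw [lintegral_const_mul _ (show Measurable fun s : ℕ → ℝ × S =>
      ENNReal.ofReal (Real.exp (-arrival s n)) by fun_prop)]
    simp

theorem monotone_arrival {S : Type*} {s : ℕ → ℝ × S} (h : ∀ i, 0 ≤ (s i).1) :
    Monotone (arrival s) :=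
  monotone_nat_of_le_succ fun n => by
    simpa [arrival, Finset.sum_range_succ] using h n

/-- The points do not accumulate, since `E[exp (-arrival s n)] = 2⁻¹ ^ n` tends to zero. -/
theorem ae_tendsto_arrival :
    ∀ᵐ s ∂markedLaw ν, Filter.Tendsto (arrival s) Filter.atTop Filter.atTop := by
  have key : ∀ M : ℕ, ∀ᵐ s ∂markedLaw ν, ∃ n, (M : ℝ) < arrival s n := by
    intro M
    rw [ae_iff]
    simp only [not_exists, not_lt]
    have hle : ∀ n, ENNReal.ofReal (Real.exp (-M)) *
        markedLaw ν {s | ∀ n, arrival s n ≤ M} ≤ 2⁻¹ ^ n := by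
      intro n
      rw [← lintegral_exp_neg_arrival ν n]
      refine le_trans (mul_le_mul_right (measure_mono ?_) _)
        (mul_meas_ge_le_lintegral (by fun_prop) _)
      intro s hs
      exact ENNReal.ofReal_le_ofReal (Real.exp_le_exp.2 (neg_le_neg (hs n)))
    have h0 := ge_of_tendsto' (ENNReal.tendsto_pow_atTop_nhds_zero_of_lt_one
      (ENNReal.inv_lt_one.2 ENNReal.one_lt_two)) hle
    rw [nonpos_iff_eq_zero, mul_eq_zero] at h0
    refine h0.resolve_left ?_
    simpa using Real.exp_pos _
  filter_upwards [ae_all_iff.2 key, ae_gap_nonneg ν] with s hs h0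
  refine Filter.tendsto_atTop_atTop_of_monotone (monotone_arrival h0) fun b => ?_
  obtain ⟨M, hM⟩ := exists_nat_ge b
  obtain ⟨n, hn⟩ := hs M
  exact ⟨n, hM.trans hn.le⟩

/-- Mecke's formula: summing over the points `t` of the process, with mark `x`, a function of
`(t, x)` and of the rest of the process amounts to adding an extra point with an independent mark,
located according to Lebesgue measure. -/
theorem lintegral_tsum_pos_remove {H : ℝ × S × (ℕ → ℝ × S) → ℝ≥0∞} (hH : Measurable H) :
    ∫⁻ s, ∑' i, H (pos s i, (s i).2, remove i s) ∂markedLaw ν =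
      ∫⁻ s, ∫⁻ t in Set.Ici 0, ∫⁻ x, H (t, x, s) ∂ν ∂volume ∂markedLaw ν := by
  have h1 : Measurable fun p : (ℕ → ℝ × S) × ℝ => ∫⁻ x, H (p.2, x, p.1) ∂ν :=
    Measurable.lintegral_prod_right' (f := fun q : ((ℕ → ℝ × S) × ℝ) × S =>
      H (q.1.2, q.2, q.1.1)) (by fun_prop)
  have h2 : ∀ i, Measurable fun p : (ℕ → ℝ × S) × ℝ => (Set.Ico (arrival p.1 i)
      (arrival p.1 (i + 1))).indicator (fun t => ∫⁻ x, H (t, x, p.1) ∂ν) p.2 := by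
    intro i
    have hs : MeasurableSet {p : (ℕ → ℝ × S) × ℝ | arrival p.1 i ≤ p.2 ∧
        p.2 < arrival p.1 (i + 1)} := by measurability
    exact h1.indicator hs
  rw [lintegral_tsum fun i => by fun_prop]
  simp_rw [lintegral_pos_remove ν _ hH]
  rw [← lintegral_tsum fun i => (Measurable.lintegral_prod_right' (h2 i)).aemeasurable]
  refine lintegral_congr_ae ?_
  filter_upwards [ae_tendsto_arrival ν, ae_gap_nonneg ν] with s hs h0
  have h3 : ∀ i, Measurable fun t : ℝ => (Set.Ico (arrival s i) (arrival s (i + 1))).indicator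
      (fun t => ∫⁻ x, H (t, x, s) ∂ν) t := fun i => (h2 i).comp measurable_prodMk_left
  rw [← lintegral_tsum fun i => (h3 i).aemeasurable,
    ← lintegral_indicator measurableSet_Ici]
  refine lintegral_congr fun t => ?_
  by_cases ht : t ∈ Set.Ici (0 : ℝ)
  · -- Exactly one of the intervals between successive points contains `t`.
    rw [Set.indicator_of_mem ht]
    have hex : ∃ n, t < arrival s n := (hs.eventually_gt_atTop t).exists
    classical
    obtain ⟨i, hi⟩ : ∃ i, Nat.find hex = i + 1 := by
      refine Nat.exists_eq_succ_of_ne_zero fun h => ?_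
      have := Nat.find_spec hex
      rw [h] at this
      simp only [arrival, Finset.range_zero, Finset.sum_empty] at this
      exact absurd ht (not_le.2 this)
    have hi1 : t < arrival s (i + 1) := hi ▸ Nat.find_spec hex
    have hi2 : arrival s i ≤ t := not_lt.1 (Nat.find_min hex (by omega))
    rw [tsum_eq_single i, Set.indicator_of_mem (Set.mem_Ico.2 ⟨hi2, hi1⟩)]
    intro j hj
    refine Set.indicator_of_notMem (fun h => ?_) _
    rcases lt_or_gt_of_ne hj with h' | h'
    · exact absurd (h.2.trans_le (monotone_arrival h0 h')) (not_lt.2 hi2)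
    · exact absurd (hi1.trans_le (monotone_arrival h0 h')) (not_lt.2 h.1)
  · rw [Set.indicator_of_notMem ht]
    refine ENNReal.tsum_eq_zero.2 fun i => Set.indicator_of_notMem (fun h => ht ?_) _
    exact le_trans (by simpa [arrival] using monotone_arrival h0 (Nat.zero_le i)) h.1

end MarkedGaps

/-! ### Numbers of points of a marked Poisson process -/

section Count

variable {S : Type*}

theorem skip_injective (i : ℕ) : Function.Injective (skip i) := by
  intro a b h
  unfold skip at h
  split_ifs at h <;> omega

theorem range_skip (i : ℕ) : Set.range (skip i) = {i}ᶜ := by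
  ext j
  constructor
  · rintro ⟨k, rfl⟩; exact skip_ne i k
  · intro hj
    have hj : j ≠ i := hj
    rcases lt_or_gt_of_ne hj with h | h
    · exact ⟨j, by simp [skip, h]⟩
    · exact ⟨j - 1, by unfold skip; split_ifs <;> omega⟩

theorem tsum_eq_add_tsum_skip (f : ℕ → ℝ≥0∞) (i : ℕ) :
    ∑' j, f j = f i + ∑' j, f (skip i j) := by
  classical
  rw [ENNReal.tsum_eq_add_tsum_ite i]
  congr 1
  have h : Function.support (fun j => if j = i then 0 else f j) ⊆ Set.range (skip i) := by
    rw [range_skip]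
    intro j hj h
    simp_all
  refine Eq.trans ?_ ((skip_injective i).tsum_eq h).symm |>.trans ?_
  · exact tsum_congr fun j => by congr
  · simp [skip_ne]

/-- The number of points, together with their marks, in the set `B`. -/
def count (B : Set (ℝ × S)) (s : ℕ → ℝ × S) : ℝ≥0∞ :=
  ∑' i, B.indicator 1 (pos s i, (s i).2)

theorem count_eq_add_remove (B : Set (ℝ × S)) (s : ℕ → ℝ × S) (i : ℕ) :
    count B s = B.indicator 1 (pos s i, (s i).2) + count B (remove i s) := by
  unfold count
  rw [tsum_eq_add_tsum_skip _ i]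
  simp only [pos_remove, remove_snd]

theorem count_eq_encard (B : Set (ℝ × S)) (s : ℕ → ℝ × S) :
    count B s = ({i | (pos s i, (s i).2) ∈ B}.encard : ℝ≥0∞) := by
  rw [← ENNReal.tsum_set_one]
  exact (tsum_subtype {i | (pos s i, (s i).2) ∈ B} (1 : ℕ → ℝ≥0∞)).symm

variable [MeasurableSpace S]

theorem measurable_count {B : Set (ℝ × S)} (hB : MeasurableSet B) : Measurable (count B) := by
  have : Measurable (B.indicator (1 : ℝ × S → ℝ≥0∞)) := measurable_one.indicator hB
  unfold count
  fun_prop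

variable (ν : Measure S) {B : Set (ℝ × S)}

/-- The expected number of points in `B`. -/
def intensity (B : Set (ℝ × S)) : ℝ≥0∞ := ∫⁻ t in Set.Ici 0, ν {x | (t, x) ∈ B}

theorem lintegral_lintegral_indicator (hB : MeasurableSet B) :
    ∫⁻ t in Set.Ici 0, ∫⁻ x, B.indicator 1 (t, x) ∂ν = intensity ν B := by
  refine lintegral_congr fun t => ?_
  exact lintegral_indicator_one (measurable_prodMk_left hB)

variable [IsProbabilityMeasure ν]

theorem lintegral_count (hB : MeasurableSet B) :
    ∫⁻ s, count B s ∂markedLaw ν = intensity ν B := by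
  have : Measurable (B.indicator (1 : ℝ × S → ℝ≥0∞)) := measurable_one.indicator hB
  rw [← lintegral_lintegral_indicator ν hB]
  exact (lintegral_tsum_pos_remove ν (H := fun p => B.indicator 1 (p.1, p.2.1))
    (by fun_prop)).trans (by simp)

theorem ae_finite_of_intensity_ne_top (hB : MeasurableSet B) (h : intensity ν B ≠ ∞) :
    ∀ᵐ s ∂markedLaw ν, {i | (pos s i, (s i).2) ∈ B}.Finite := by
  rw [← lintegral_count ν hB] at h
  filter_upwards [ae_lt_top (measurable_count hB) h] with s hs
  rw [count_eq_encard] at hs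
  rw [← Set.encard_lt_top_iff]
  simpa using hs

/-- The recursion satisfied by the Poisson distribution, from Mecke's formula. -/
theorem succ_mul_measure_count_eq (hB : MeasurableSet B) (k : ℕ) :
    ((k + 1 : ℕ) : ℝ≥0∞) * markedLaw ν {s | count B s = (k + 1 : ℕ)} =
      intensity ν B * markedLaw ν {s | count B s = k} := by
  have hb : Measurable (B.indicator (1 : ℝ × S → ℝ≥0∞)) := measurable_one.indicator hB
  have hN : ∀ k : ℕ, MeasurableSet {s : ℕ → ℝ × S | count B s = k} := fun k =>
    measurable_count hB (measurableSet_singleton _)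
  have hNm : ∀ k : ℕ, Measurable
      ({s : ℕ → ℝ × S | count B s = k}.indicator (1 : (ℕ → ℝ × S) → ℝ≥0∞)) := fun k =>
    measurable_one.indicator (hN k)
  have hk := hNm k
  have key := lintegral_tsum_pos_remove ν (H := fun p => B.indicator 1 (p.1, p.2.1) *
    {s : ℕ → ℝ × S | count B s = k}.indicator 1 p.2.2) (by fun_prop)
  have hl : ∀ s : ℕ → ℝ × S, ∑' i, B.indicator 1 (pos s i, (s i).2) *
      {s : ℕ → ℝ × S | count B s = k}.indicator (1 : (ℕ → ℝ × S) → ℝ≥0∞) (remove i s) =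
      (k + 1 : ℕ) * {s : ℕ → ℝ × S | count B s = (k + 1 : ℕ)}.indicator 1 s := by
    intro s
    trans ∑' i, B.indicator 1 (pos s i, (s i).2) *
      {s : ℕ → ℝ × S | count B s = (k + 1 : ℕ)}.indicator (1 : (ℕ → ℝ × S) → ℝ≥0∞) s
    · refine tsum_congr fun i => ?_
      have h := count_eq_add_remove B s i
      by_cases hi : (pos s i, (s i).2) ∈ B
      · rw [Set.indicator_of_mem hi] at h ⊢
        have : count B s = (k + 1 : ℕ) ↔ count B (remove i s) = k := by
          rw [h, Nat.cast_add, add_comm, Nat.cast_one, Pi.one_apply,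
            ENNReal.add_left_inj ENNReal.one_ne_top]
        simp only [Set.indicator, Set.mem_ofPred_eq, this, Pi.one_apply]
      · simp [hi]
    · rw [ENNReal.tsum_mul_right]
      by_cases h : count B s = (k + 1 : ℕ)
      · rw [← h, count]
      · have h : s ∉ {s : ℕ → ℝ × S | count B s = (k + 1 : ℕ)} := h
        rw [Set.indicator_of_notMem h, mul_zero, mul_zero]
  simp only [hl] at key
  rw [lintegral_const_mul _ (hNm (k + 1)), lintegral_indicator_one (hN _)] at key
  rw [key, ← lintegral_indicator_one (hN k), ← lintegral_const_mul _ hk,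
    ← lintegral_lintegral_indicator ν hB]
  refine lintegral_congr fun s => ?_
  rw [← lintegral_mul_const _ (Measurable.lintegral_prod_right' hb)]
  refine lintegral_congr fun t => ?_
  have ht : Measurable fun x => B.indicator (1 : ℝ × S → ℝ≥0∞) (t, x) :=
    hb.comp measurable_prodMk_left
  rw [← lintegral_mul_const _ ht]

/-- The void probabilities of a marked Poisson process. The recursion determines the law of the
number of points in `B` up to the factor `P(count B = 0)`, which the total mass fixes. -/
theorem measure_forall_notMem (hB : MeasurableSet B) (h : intensity ν B ≠ ∞) :
    markedLaw ν {s | ∀ i, (pos s i, (s i).2) ∉ B} =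
      ENNReal.ofReal (Real.exp (-(intensity ν B).toReal)) := by
  set l := (intensity ν B).toReal with hl
  have hl0 : 0 ≤ l := ENNReal.toReal_nonneg
  have hlam : intensity ν B = ENNReal.ofReal l := (ENNReal.ofReal_toReal h).symm
  have hN : ∀ k : ℕ, MeasurableSet {s : ℕ → ℝ × S | count B s = k} := fun k =>
    measurable_count hB (measurableSet_singleton _)
  have hpk : ∀ k : ℕ, markedLaw ν {s | count B s = k} =
      ENNReal.ofReal (l ^ k / k.factorial) * markedLaw ν {s | count B s = (0 : ℕ)} := by
    intro k
    induction k with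
    | zero => simp
    | succ k ih =>
      have h1 := succ_mul_measure_count_eq ν hB k
      rw [ih, hlam, ← mul_assoc, ← ENNReal.ofReal_mul hl0] at h1
      have h2 : ((k + 1 : ℕ) : ℝ≥0∞) ≠ 0 := by simp
      rw [← ENNReal.mul_right_inj h2 (ENNReal.natCast_ne_top _), h1, ← mul_assoc,
        ← ENNReal.ofReal_natCast (k + 1), ← ENNReal.ofReal_mul (by positivity)]
      congr 2
      rw [Nat.factorial_succ]
      push_cast
      field_simp
      ring
  have hsum : ∑' k : ℕ, markedLaw ν {s | count B s = k} = 1 := by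
    rw [← measure_iUnion _ hN, ← measure_univ (μ := markedLaw ν)]
    · refine measure_congr ?_
      rw [Filter.eventuallyEq_univ]
      filter_upwards [ae_finite_of_intensity_ne_top ν hB h] with s hs
      simp only [Set.mem_iUnion, Set.mem_ofPred_eq]
      refine ⟨{i | (pos s i, (s i).2) ∈ B}.ncard, ?_⟩
      rw [count_eq_encard, ← hs.cast_ncard_eq]
      simp
    · intro i j hij
      rw [Function.onFun, Set.disjoint_left]
      intro s hi hj
      exact hij (by exact_mod_cast hi.symm.trans hj)
  rw [tsum_congr hpk] at hsum
  rw [ENNReal.tsum_mul_right, ← ENNReal.ofReal_tsum_of_nonneg (fun k => by positivity)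
    (Real.summable_pow_div_factorial l)] at hsum
  have hexp : ∑' k : ℕ, l ^ k / k.factorial = Real.exp l := by
    rw [Real.exp_eq_exp_ℝ, NormedSpace.exp_eq_tsum_div]
  rw [hexp] at hsum
  have hset : {s : ℕ → ℝ × S | ∀ i, (pos s i, (s i).2) ∉ B} = {s | count B s = (0 : ℕ)} := by
    ext s
    simp [count, ENNReal.tsum_eq_zero]
  rw [hset, ← one_mul (markedLaw ν _), ← ENNReal.ofReal_one, ← Real.exp_zero,
    ← neg_add_cancel l, Real.exp_add, ENNReal.ofReal_mul (Real.exp_nonneg _), mul_assoc, hsum,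
    mul_one]

/-- Shifting the points by a function of their marks almost surely produces no coincidences. -/
theorem ae_injective_pos_sub {Y : S → ℝ} (hY : Measurable Y) :
    ∀ᵐ s ∂markedLaw ν, ∀ i j, i ≠ j → pos s i - Y (s i).2 ≠ pos s j - Y (s j).2 := by
  set A : Set (ℝ × S × (ℕ → ℝ × S)) := {p | ∃ j, p.1 - Y p.2.1 = pos p.2.2 j - Y (p.2.2 j).2}
    with hA
  have hAm : MeasurableSet A := by
    have : A = ⋃ j, {p | p.1 - Y p.2.1 = pos p.2.2 j - Y (p.2.2 j).2} := by ext; simp [A]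
    rw [this]
    exact MeasurableSet.iUnion fun j => measurableSet_eq_fun (by fun_prop) (by fun_prop)
  have hAi : Measurable (A.indicator (1 : ℝ × S × (ℕ → ℝ × S) → ℝ≥0∞)) :=
    measurable_one.indicator hAm
  have key := lintegral_tsum_pos_remove ν hAi
  -- For given marks and given other points, an extra point lies in a countable set.
  have h0 : ∀ s : ℕ → ℝ × S, ∫⁻ t in Set.Ici 0, ∫⁻ x, A.indicator 1 (t, x, s) ∂ν = 0 := by
    intro s
    have hs : Measurable fun p : ℝ × S =>
      A.indicator (1 : ℝ × S × (ℕ → ℝ × S) → ℝ≥0∞) (p.1, p.2, s) := hAi.comp (by fun_prop)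
    rw [lintegral_lintegral_swap hs.aemeasurable]
    refine lintegral_eq_zero_of_ae_eq_zero (Filter.Eventually.of_forall fun x => ?_)
    rw [Pi.zero_apply, ← nonpos_iff_eq_zero]
    have hc : (Set.range fun j => pos s j - Y (s j).2 + Y x).Countable := Set.countable_range _
    have hz := hc.measure_zero (volume.restrict (Set.Ici 0))
    rw [← hz, ← lintegral_indicator_one hc.measurableSet]
    refine lintegral_mono fun t => ?_
    by_cases ht : (t, x, s) ∈ A
    · obtain ⟨j, hj⟩ := ht
      rw [Set.indicator_of_mem (s := Set.range _) ⟨j, by dsimp only at hj ⊢; linarith⟩]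
      exact Set.indicator_le_self' (fun _ _ => zero_le) _
    · rw [Set.indicator_of_notMem ht]; exact zero_le
  simp only [h0, lintegral_zero] at key
  rw [lintegral_eq_zero_iff (by fun_prop)] at key
  filter_upwards [key] with s hs i j hij h
  have h1 := ENNReal.tsum_eq_zero.1 hs i
  obtain ⟨k, hk⟩ : j ∈ Set.range (skip i) := by rw [range_skip]; exact hij.symm
  rw [Set.indicator_of_mem] at h1
  · exact one_ne_zero h1
  · exact ⟨k, by dsimp only; rw [pos_remove, remove_snd, hk, h]⟩

end Count

/-! ### The message recursion for fixed edge lengths -/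

instance : Countable DirEdge :=
  Function.Injective.countable (f := fun d : DirEdge => d.toProd) fun _ _ h =>
    SimpleGraph.Dart.ext _ _ h

theorem dirEdge_ext {d d' : DirEdge} (h1 : d.fst = d'.fst) (h2 : d.snd = d'.snd) : d = d' :=
  SimpleGraph.Dart.ext _ _ (Prod.ext h1 h2)

theorem und_symm (d : DirEdge) : und d.symm = und d := Subtype.ext (by simp [und])

theorem und_eq_und_iff {d d' : DirEdge} : und d = und d' ↔ d = d' ∨ d = d'.symm := by
  rw [und, und, Subtype.mk.injEq, SimpleGraph.dart_edge_eq_iff]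

theorem eq_down_or_eq_symm_down (d : DirEdge) : ∃ v i, d = down v i ∨ d = (down v i).symm := by
  rcases d.adj with ⟨i, h⟩ | ⟨i, h⟩
  · exact ⟨d.fst, i, Or.inl (dirEdge_ext rfl h)⟩
  · exact ⟨d.snd, i, Or.inr (dirEdge_ext h rfl)⟩

/-- The directed edges that continue `d` without backtracking. -/
def next (d : DirEdge) : Set DirEdge := {d' | d'.fst = d.snd ∧ d'.snd ≠ d.fst}

instance nonempty_next (d : DirEdge) : Nonempty (next d) := by
  by_cases h : 0 :: d.snd = d.fst
  · refine ⟨⟨down d.snd 1, rfl, fun h' => ?_⟩⟩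
    simpa using List.head_eq_of_cons_eq (h'.trans h.symm)
  · exact ⟨⟨down d.snd 0, rfl, h⟩⟩

/-- `x` solves the message recursion for the edge lengths `ℓ`. -/
def IsSolution (ℓ : Edge → ℝ) (x : DirEdge → ℝ) : Prop :=
  ∀ d, IsLeast (reduced ℓ x '' next d) (x d)

/-- One step of the message recursion. -/
def update (ℓ : Edge → ℝ) (x : DirEdge → ℝ) (d : DirEdge) : ℝ :=
  ⨅ d' : next d, reduced ℓ x d'

/-- The iterates of the message recursion, started from zero. -/
def iter (ℓ : Edge → ℝ) : ℕ → DirEdge → ℝ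
  | 0 => 0
  | n + 1 => update ℓ (iter ℓ n)

/-- The decreasing limit of the odd iterates. -/
def upper (ℓ : Edge → ℝ) (d : DirEdge) : ℝ := ⨅ k : ℕ, iter ℓ (2 * k + 1) d

/-- The increasing limit of the even iterates. -/
def lower (ℓ : Edge → ℝ) (d : DirEdge) : ℝ := ⨆ k : ℕ, iter ℓ (2 * k) d

variable {ℓ : Edge → ℝ} {x y : DirEdge → ℝ}

theorem reduced_nonneg (d : DirEdge) : 0 ≤ reduced ℓ x d := le_max_right _ _

theorem reduced_anti {d : DirEdge} (h : x d ≤ y d) : reduced ℓ y d ≤ reduced ℓ x d :=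
  max_le_max (by linarith) le_rfl

theorem update_le {d d' : DirEdge} (h : d' ∈ next d) : update ℓ x d ≤ reduced ℓ x d' :=
  ciInf_le (f := fun d' : next d => reduced ℓ x d')
    ⟨0, by rintro _ ⟨d', rfl⟩; exact reduced_nonneg _⟩ ⟨d', h⟩

theorem le_update {d : DirEdge} {a : ℝ} (h : ∀ d' ∈ next d, a ≤ reduced ℓ x d') :
    a ≤ update ℓ x d := le_ciInf fun d' => h d' d'.2

theorem update_nonneg (d : DirEdge) : 0 ≤ update ℓ x d := le_update fun _ _ => reduced_nonneg _

theorem update_anti (h : x ≤ y) : update ℓ y ≤ update ℓ x := fun _ =>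
  le_update fun d' hd' => (update_le hd').trans (reduced_anti (h d'))

theorem iter_nonneg (n : ℕ) (d : DirEdge) : 0 ≤ iter ℓ n d := by
  cases n with
  | zero => exact le_rfl
  | succ n => exact update_nonneg d

theorem iter_succ_le_iter_one (n : ℕ) : iter ℓ (n + 1) ≤ iter ℓ 1 :=
  update_anti (x := iter ℓ 0) fun d => iter_nonneg n d

theorem iter_even_le_and_odd_le (k : ℕ) :
    iter ℓ (2 * k) ≤ iter ℓ (2 * k + 2) ∧ iter ℓ (2 * k + 3) ≤ iter ℓ (2 * k + 1) := by
  induction k with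
  | zero =>
    have h : iter ℓ 0 ≤ iter ℓ 2 := fun d => iter_nonneg 2 d
    exact ⟨h, update_anti h⟩
  | succ k ih =>
    have h : iter ℓ (2 * (k + 1)) ≤ iter ℓ (2 * (k + 1) + 2) := update_anti ih.2
    exact ⟨h, update_anti h⟩

theorem monotone_iter_even (d : DirEdge) : Monotone fun k : ℕ => iter ℓ (2 * k) d :=
  monotone_nat_of_le_succ fun k => (iter_even_le_and_odd_le k).1 d

theorem antitone_iter_odd (d : DirEdge) : Antitone fun k : ℕ => iter ℓ (2 * k + 1) d :=
  antitone_nat_of_succ_le fun k => (iter_even_le_and_odd_le k).2 d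

theorem iter_even_le_iter_succ (k : ℕ) : iter ℓ (2 * k) ≤ iter ℓ (2 * k + 1) := by
  induction k with
  | zero => exact fun d => iter_nonneg 1 d
  | succ k ih => exact update_anti (update_anti ih)

theorem iter_even_le_iter_odd (k l : ℕ) (d : DirEdge) : iter ℓ (2 * k) d ≤ iter ℓ (2 * l + 1) d :=
  (monotone_iter_even d (le_max_left k l)).trans
    ((iter_even_le_iter_succ _ d).trans (antitone_iter_odd d (le_max_right k l)))

theorem iter_even_le_lower (k : ℕ) (d : DirEdge) : iter ℓ (2 * k) d ≤ lower ℓ d :=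
  le_ciSup (f := fun k : ℕ => iter ℓ (2 * k) d)
    ⟨iter ℓ 1 d, by rintro _ ⟨k, rfl⟩; exact iter_even_le_iter_odd k 0 d⟩ k

theorem upper_le_iter_odd (k : ℕ) (d : DirEdge) : upper ℓ d ≤ iter ℓ (2 * k + 1) d :=
  ciInf_le (f := fun k : ℕ => iter ℓ (2 * k + 1) d)
    ⟨0, by rintro _ ⟨k, rfl⟩; exact iter_nonneg _ d⟩ k

theorem lower_le_upper (d : DirEdge) : lower ℓ d ≤ upper ℓ d :=
  ciSup_le fun k => le_ciInf fun l => iter_even_le_iter_odd k l d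

theorem lower_nonneg (d : DirEdge) : 0 ≤ lower ℓ d := iter_even_le_lower 0 d

theorem upper_nonneg (d : DirEdge) : 0 ≤ upper ℓ d := (lower_nonneg d).trans (lower_le_upper d)

theorem upper_le_iter_one (d : DirEdge) : upper ℓ d ≤ iter ℓ 1 d := upper_le_iter_odd 0 d

theorem IsSolution.eq_update (h : IsSolution ℓ x) : x = update ℓ x := by
  funext d
  refine le_antisymm (le_update fun d' hd' => (h d).2 ⟨d', hd', rfl⟩) ?_
  obtain ⟨d', hd', he⟩ := (h d).1
  exact he ▸ update_le hd'

/-- Every solution of the recursion lies between the limits of the even and the odd iterates. -/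
theorem IsSolution.lower_le_and_le_upper (h : IsSolution ℓ x) (d : DirEdge) :
    lower ℓ d ≤ x d ∧ x d ≤ upper ℓ d := by
  have hk : ∀ k, iter ℓ (2 * k) ≤ x ∧ x ≤ iter ℓ (2 * k + 1) := by
    intro k
    induction k with
    | zero =>
      have h0 : iter ℓ 0 ≤ x := fun d => by rw [h.eq_update]; exact update_nonneg d
      refine ⟨h0, ?_⟩
      rw [h.eq_update]
      exact update_anti h0
    | succ k ih =>
      have h1 : iter ℓ (2 * (k + 1)) ≤ x := by
        rw [h.eq_update]
        exact update_anti ih.2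
      refine ⟨h1, ?_⟩
      rw [h.eq_update]
      exact update_anti h1
  exact ⟨ciSup_le fun k => (hk k).1 d, le_ciInf fun k => (hk k).2 d⟩

/-- At each vertex only finitely many edges have a small value of `ξ(v,w) - X(v,w)`, for the first
iterate `X`, which bounds all solutions of the recursion. -/
def LocallyFinite (ℓ : Edge → ℝ) : Prop :=
  ∀ v : Word, ∀ M : ℕ, {d : DirEdge | d.fst = v ∧ ℓ (und d) - iter ℓ 1 d ≤ M}.Finite

theorem LocallyFinite.finite_reduced_le (hℓ : LocallyFinite ℓ) (hx : x ≤ iter ℓ 1) (v : Word)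
    (c : ℝ) : {d : DirEdge | d.fst = v ∧ reduced ℓ x d ≤ c}.Finite := by
  obtain ⟨M, hM⟩ := exists_nat_ge c
  refine (hℓ v M).subset fun d hd => ⟨hd.1, ?_⟩
  have h1 := (le_max_left _ _).trans hd.2
  have h2 := hx d
  linarith

theorem LocallyFinite.exists_isLeast (hℓ : LocallyFinite ℓ) (hx : x ≤ iter ℓ 1) (d : DirEdge) :
    ∃ m, IsLeast (reduced ℓ x '' next d) m := by
  obtain ⟨⟨d₀, h₀⟩⟩ := nonempty_next d
  have hfin : {d' ∈ next d | reduced ℓ x d' ≤ reduced ℓ x d₀}.Finite :=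
    (hℓ.finite_reduced_le hx d.snd (reduced ℓ x d₀)).subset fun d' hd' => ⟨hd'.1.1, hd'.2⟩
  obtain ⟨d₁, h₁, hmin⟩ := Set.exists_min_image _ (reduced ℓ x) hfin ⟨d₀, h₀, le_rfl⟩
  refine ⟨reduced ℓ x d₁, ⟨d₁, h₁.1, rfl⟩, ?_⟩
  rintro _ ⟨d', hd', rfl⟩
  rcases le_total (reduced ℓ x d') (reduced ℓ x d₀) with h | h
  · exact hmin d' ⟨hd', h⟩
  · exact h₁.2.trans h

theorem LocallyFinite.isLeast_upper (hℓ : LocallyFinite ℓ) (d : DirEdge) :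
    IsLeast (reduced ℓ (lower ℓ) '' next d) (upper ℓ d) := by
  obtain ⟨m, hm⟩ := hℓ.exists_isLeast
    (fun d => (lower_le_upper d).trans (upper_le_iter_one d)) d
  have h1 : ∀ d' ∈ next d, upper ℓ d ≤ reduced ℓ (lower ℓ) d' := by
    intro d' hd'
    rcases le_or_gt (upper ℓ d) 0 with h0 | h0
    · exact h0.trans (reduced_nonneg _)
    refine le_max_of_le_left ?_
    have : lower ℓ d' ≤ ℓ (und d') - upper ℓ d := by
      refine ciSup_le fun k => ?_
      have h : upper ℓ d ≤ reduced ℓ (iter ℓ (2 * k)) d' :=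
        (upper_le_iter_odd k d).trans (update_le hd')
      rcases le_max_iff.1 h with h | h <;> linarith
    linarith
  have h2 : m ≤ upper ℓ d := le_ciInf fun k => le_update fun d' hd' =>
    (hm.2 ⟨d', hd', rfl⟩).trans (reduced_anti (iter_even_le_lower k d'))
  have h3 : upper ℓ d ≤ m := by
    obtain ⟨d', hd', he⟩ := hm.1
    exact he ▸ h1 d' hd'
  rwa [le_antisymm h3 h2]

theorem LocallyFinite.isLeast_lower (hℓ : LocallyFinite ℓ) (d : DirEdge) :
    IsLeast (reduced ℓ (upper ℓ) '' next d) (lower ℓ d) := by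
  obtain ⟨m, hm⟩ := hℓ.exists_isLeast (x := upper ℓ) (fun d => upper_le_iter_one d) d
  have h1 : lower ℓ d ≤ m := by
    obtain ⟨d', hd', rfl⟩ := hm.1
    refine ciSup_le fun k => ?_
    cases k with
    | zero => exact reduced_nonneg _
    | succ k => exact (update_le hd').trans (reduced_anti (upper_le_iter_odd k d'))
  suffices h2 : m ≤ lower ℓ d by rwa [le_antisymm h1 h2]
  by_contra! hlt
  obtain ⟨c, hc1, hc2⟩ := exists_between hlt
  have hc0 : 0 < c := (lower_nonneg d).trans_lt hc1
  -- The values of the odd iterates below `c` are attained on a fixed finite set of edges, on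
  -- which the odd iterates converge uniformly.
  set F : Set DirEdge := {d' ∈ next d | reduced ℓ (iter ℓ 1) d' ≤ c} with hF
  have hFfin : F.Finite := (hℓ.finite_reduced_le le_rfl d.snd c).subset
    fun d' hd' => ⟨hd'.1.1, hd'.2⟩
  have hev : ∀ᶠ k : ℕ in Filter.atTop, ∀ d' ∈ F, c < reduced ℓ (iter ℓ (2 * k + 1)) d' := by
    rw [Filter.eventually_all_finite hFfin]
    intro d' hd'
    have hm' : c < reduced ℓ (upper ℓ) d' := hc2.trans_le (hm.2 ⟨d', hd'.1, rfl⟩)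
    have hu : upper ℓ d' < ℓ (und d') - c := by
      rcases lt_max_iff.1 hm' with h | h <;> linarith
    obtain ⟨K, hK⟩ := exists_lt_of_ciInf_lt hu
    filter_upwards [Filter.eventually_ge_atTop K] with k hk
    have := antitone_iter_odd (ℓ := ℓ) d' hk
    refine lt_max_of_lt_left ?_
    dsimp only at this
    linarith
  obtain ⟨k, hk⟩ := hev.exists
  have hlt' : update ℓ (iter ℓ (2 * k + 1)) d < c :=
    (iter_even_le_lower (k + 1) d).trans_lt hc1
  obtain ⟨⟨d', hd'⟩, h⟩ := exists_lt_of_ciInf_lt hlt'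
  have hd'F : d' ∈ F := ⟨hd', (reduced_anti (iter_succ_le_iter_one _ d')).trans h.le⟩
  exact absurd h (not_lt.2 (hk d' hd'F).le)

/-- If the two limits agree on the edges directed away from the root, they agree everywhere. -/
theorem LocallyFinite.lower_eq_upper (hℓ : LocallyFinite ℓ)
    (h : ∀ v i, lower ℓ (down v i) = upper ℓ (down v i)) : lower ℓ = upper ℓ := by
  have hup : ∀ v i, lower ℓ (down v i).symm = upper ℓ (down v i).symm := by
    intro v
    induction v with
    | nil =>
      intro i
      refine (hℓ.isLeast_lower _).unique ?_
      convert! hℓ.isLeast_upper (down [] i).symm using 1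
      refine Set.image_congr fun d hd => ?_
      obtain ⟨v, j, rfl | rfl⟩ := eq_down_or_eq_symm_down d
      · simp only [reduced, h]
      · exact absurd hd.1 (List.cons_ne_nil _ _)
    | cons j v ih =>
      intro i
      refine (hℓ.isLeast_lower _).unique ?_
      convert! hℓ.isLeast_upper (down (j :: v) i).symm using 1
      refine Set.image_congr fun d hd => ?_
      obtain ⟨w, k, rfl | rfl⟩ := eq_down_or_eq_symm_down d
      · simp only [reduced, h]
      · have hw : k :: w = j :: v := hd.1
        obtain ⟨rfl, rfl⟩ := List.cons.inj hw
        simp only [reduced, ih]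
  funext d
  obtain ⟨v, i, rfl | rfl⟩ := eq_down_or_eq_symm_down d
  exacts [h v i, hup v i]

theorem LocallyFinite.isSolution_upper (hℓ : LocallyFinite ℓ)
    (h : ∀ v i, lower ℓ (down v i) = upper ℓ (down v i)) : IsSolution ℓ (upper ℓ) := fun d => by
  have := hℓ.isLeast_upper d
  rwa [hℓ.lower_eq_upper h] at this

theorem IsSolution.eq_upper (hx : IsSolution ℓ x) (h : lower ℓ = upper ℓ) : x = upper ℓ :=
  funext fun d => le_antisymm (hx.lower_le_and_le_upper d).2
    (congrFun h d ▸ (hx.lower_le_and_le_upper d).1)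

theorem IsSolution.nonneg (h : IsSolution ℓ x) (d : DirEdge) : 0 ≤ x d :=
  (lower_nonneg d).trans (h.lower_le_and_le_upper d).1

/-! ### The cover defined by a solution -/

theorem snd_mem_optChoice_iff_forall {d : DirEdge} :
    d.snd ∈ optChoice ℓ x d.fst ↔
      ∀ d' : DirEdge, d'.fst = d.fst → reduced ℓ x d ≤ reduced ℓ x d' := by
  constructor
  · rintro ⟨d₁, h1, h2, h3⟩
    obtain rfl := dirEdge_ext h1 h2
    exact h3
  · exact fun h => ⟨d, rfl, rfl, h⟩

theorem IsSolution.snd_mem_optChoice_iff (h : IsSolution ℓ x) (d : DirEdge) :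
    d.snd ∈ optChoice ℓ x d.fst ↔ ℓ (und d) ≤ x d + x d.symm := by
  have h1 : d.snd ∈ optChoice ℓ x d.fst ↔ reduced ℓ x d ≤ x d.symm := by
    rw [snd_mem_optChoice_iff_forall]
    constructor
    · intro hd
      obtain ⟨d', hd', he⟩ := (h d.symm).1
      exact he ▸ hd d' hd'.1
    · intro hd d' hd'
      by_cases hs : d'.snd = d.snd
      · rw [dirEdge_ext hd' hs]
      · exact hd.trans ((h d.symm).2 ⟨d', ⟨hd', hs⟩, rfl⟩)
  rw [h1, reduced, max_le_iff, and_iff_left (h.nonneg _), sub_le_iff_le_add']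

/-- The cover defined by a solution consists of the edges whose length is at most the sum of the
two messages along the edge. -/
theorem IsSolution.und_mem_optCover_iff (h : IsSolution ℓ x) (d : DirEdge) :
    und d ∈ optCover ℓ x ↔ ℓ (und d) ≤ x d + x d.symm := by
  constructor
  · rintro ⟨d', hd', he⟩
    rw [h.snd_mem_optChoice_iff] at hd'
    rcases und_eq_und_iff.1 he with rfl | rfl
    · exact hd'
    · rwa [und_symm, SimpleGraph.Dart.symm_symm, add_comm] at hd'
  · exact fun hd => ⟨d, (h.snd_mem_optChoice_iff d).2 hd, rfl⟩

theorem IsSolution.covers (h : IsSolution ℓ x) : Covers (optCover ℓ x) := by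
  intro v
  -- Either the edge to the first child is optimal at `v`, or the optimum over the other edges is.
  obtain ⟨d', hd', he⟩ := (h (down v 0).symm).1
  rcases le_total (reduced ℓ x (down v 0)) (reduced ℓ x d') with hle | hle
  · refine ⟨down v 0, rfl, down v 0, snd_mem_optChoice_iff_forall.2 fun d hd => ?_, rfl⟩
    by_cases hs : d.snd = 0 :: v
    · rw [dirEdge_ext (d' := down v 0) hd hs]
    · exact hle.trans (he.trans_le ((h (down v 0).symm).2 ⟨d, ⟨hd, hs⟩, rfl⟩))
  · have hv : d'.fst = v := hd'.1
    refine ⟨d', hv, d', snd_mem_optChoice_iff_forall.2 fun d hd => ?_, rfl⟩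
    rw [hv] at hd
    by_cases hs : d.snd = 0 :: v
    · rwa [dirEdge_ext (d' := down v 0) hd hs]
    · exact he.trans_le ((h (down v 0).symm).2 ⟨d, ⟨hd, hs⟩, rfl⟩)

/-! ### Measurability and equivariance -/

@[fun_prop]
theorem measurable_iter (n : ℕ) (d : DirEdge) : Measurable fun ℓ : Edge → ℝ => iter ℓ n d := by
  induction n generalizing d with
  | zero => exact measurable_const
  | succ n ih =>
    refine Measurable.iInf fun d' => ?_
    unfold reduced
    fun_prop

@[fun_prop]
theorem measurable_upper (d : DirEdge) : Measurable fun ℓ : Edge → ℝ => upper ℓ d :=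
  Measurable.iInf fun _ => measurable_iter _ d

theorem measurable_optCover :
    Measurable fun p : (Edge → ℝ) × (DirEdge → ℝ) => optCover p.1 p.2 := by
  refine measurable_set_iff.2 fun e => ?_
  have : ∀ p : (Edge → ℝ) × (DirEdge → ℝ), e ∈ optCover p.1 p.2 ↔ ∃ d : DirEdge,
      (∀ d' : DirEdge, d'.fst = d.fst → reduced p.1 p.2 d ≤ reduced p.1 p.2 d') ∧ und d = e := by
    intro p
    simp only [optCover, Set.mem_ofPred_eq, snd_mem_optChoice_iff_forall]
  simp only [this]
  have hr : ∀ d, Measurable fun p : (Edge → ℝ) × (DirEdge → ℝ) => reduced p.1 p.2 d := by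
    intro d
    unfold reduced
    fun_prop
  refine Measurable.exists fun d => Measurable.and (Measurable.forall fun d' =>
    Measurable.imp measurable_const ?_) measurable_const
  exact measurableSet_setOfPred.1 (measurableSet_le (hr d) (hr d'))

section Equivariance

variable (γ : tree ≃g tree)

/-- The action of a tree automorphism on the directed edges. -/
def mapDir (d : DirEdge) : DirEdge := ⟨(γ d.fst, γ d.snd), γ.map_adj_iff.2 d.adj⟩

theorem und_mapDir (d : DirEdge) : und (mapDir γ d) = γ.mapEdgeSet (und d) := rfl

theorem mapDir_symm_mapDir (d : DirEdge) : mapDir γ (mapDir γ.symm d) = d :=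
  dirEdge_ext (γ.apply_symm_apply _) (γ.apply_symm_apply _)

theorem mapDir_mem_next {d d' : DirEdge} : mapDir γ d' ∈ next (mapDir γ d) ↔ d' ∈ next d := by
  simp [next, mapDir]

variable {γ} {ℓ' : Edge → ℝ} (hℓ : ∀ e, ℓ' (γ.mapEdgeSet e) = ℓ e)
include hℓ

theorem iter_mapDir (n : ℕ) (d : DirEdge) : iter ℓ' n (mapDir γ d) = iter ℓ n d := by
  induction n generalizing d with
  | zero => rfl
  | succ n ih =>
    have hr : ∀ d, reduced ℓ' (iter ℓ' n) (mapDir γ d) = reduced ℓ (iter ℓ n) d := fun d => by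
      rw [reduced, reduced, ih, und_mapDir, hℓ]
    refine le_antisymm (le_update fun d' hd' => ?_) (le_update fun d' hd' => ?_)
    · exact (update_le ((mapDir_mem_next γ).2 hd')).trans_eq (hr d')
    · rw [← mapDir_symm_mapDir γ d'] at hd' ⊢
      rw [hr]
      exact update_le ((mapDir_mem_next γ).1 hd')

theorem upper_mapDir (d : DirEdge) : upper ℓ' (mapDir γ d) = upper ℓ d := by
  simp only [upper, iter_mapDir hℓ]

theorem mapEdgeSet_mem_optCover (e : Edge) :
    γ.mapEdgeSet e ∈ optCover ℓ' (upper ℓ') ↔ e ∈ optCover ℓ (upper ℓ) := by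
  have hr : ∀ d, reduced ℓ' (upper ℓ') (mapDir γ d) = reduced ℓ (upper ℓ) d := fun d => by
    rw [reduced, reduced, upper_mapDir hℓ, und_mapDir, hℓ]
  have hopt : ∀ d, (mapDir γ d).snd ∈ optChoice ℓ' (upper ℓ') (mapDir γ d).fst ↔
      d.snd ∈ optChoice ℓ (upper ℓ) d.fst := by
    intro d
    rw [snd_mem_optChoice_iff_forall, snd_mem_optChoice_iff_forall]
    constructor
    · intro h d' hd'
      rw [← hr, ← hr]
      exact h _ (congrArg γ hd')
    · intro h d' hd'
      rw [← mapDir_symm_mapDir γ d'] at hd' ⊢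
      rw [hr, hr]
      exact h _ (γ.injective hd')
  constructor
  · rintro ⟨d, hd, he⟩
    rw [← mapDir_symm_mapDir γ d] at hd he
    exact ⟨_, (hopt _).1 hd, γ.mapEdgeSet.injective he⟩
  · rintro ⟨d, hd, rfl⟩
    exact ⟨_, (hopt _).2 hd, rfl⟩

end Equivariance

/-! ### The law of a message computed from independent messages -/

section ShiftedMin

variable {S : Type*}

/-- The smallest of the points after shifting them by a function of their marks, truncated at
zero. -/
def shiftedMin (Y : S → ℝ) (s : ℕ → ℝ × S) : ℝ := ⨅ i, max (pos s i - Y (s i).2) 0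

theorem bddBelow_shiftedMin (Y : S → ℝ) (s : ℕ → ℝ × S) :
    BddBelow (Set.range fun i => max (pos s i - Y (s i).2) 0) :=
  ⟨0, by rintro _ ⟨i, rfl⟩; exact le_max_right _ _⟩

theorem shiftedMin_nonneg (Y : S → ℝ) (s : ℕ → ℝ × S) : 0 ≤ shiftedMin Y s :=
  le_ciInf fun _ => le_max_right _ _

variable [MeasurableSpace S] (ν : Measure S) [IsProbabilityMeasure ν] {Y : S → ℝ}

theorem measurable_shiftedMin (hY : Measurable Y) : Measurable (shiftedMin Y) :=
  Measurable.iInf fun i => by fun_prop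

theorem measurableSet_sub_le (hY : Measurable Y) (y : ℝ) :
    MeasurableSet {p : ℝ × S | p.1 - Y p.2 ≤ y} :=
  measurableSet_le (by fun_prop) measurable_const

/-- For a mark `x`, the points `t ≥ 0` with `t - Y x ≤ y` form an interval of length `y + Y x`. -/
theorem intensity_sub_le (hY : Measurable Y) (h0 : ∀ x, 0 ≤ Y x) {y : ℝ} (hy : 0 ≤ y) :
    intensity ν {p | p.1 - Y p.2 ≤ y} = ENNReal.ofReal y + ∫⁻ x, ENNReal.ofReal (Y x) ∂ν := by
  have h := lintegral_eq_lintegral_meas_le ν (f := fun x => y + Y x)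
    (Filter.Eventually.of_forall fun x => add_nonneg hy (h0 x)) (by fun_prop)
  simp_rw [ENNReal.ofReal_add hy (h0 _)] at h
  rw [lintegral_add_left (by fun_prop), lintegral_const, measure_univ, mul_one] at h
  rw [h, intensity, Measure.restrict_congr_set Ioi_ae_eq_Ici]
  simp

/-- The probability that all shifted points exceed `y`. -/
theorem measure_forall_lt_sub (hY : Measurable Y) (h0 : ∀ x, 0 ≤ Y x)
    (he : ∫⁻ x, ENNReal.ofReal (Y x) ∂ν ≠ ∞) {y : ℝ} (hy : 0 ≤ y) :
    markedLaw ν {s | ∀ i, y < pos s i - Y (s i).2} =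
      ENNReal.ofReal (Real.exp (-(∫⁻ x, ENNReal.ofReal (Y x) ∂ν).toReal) * Real.exp (-y)) := by
  have hi := intensity_sub_le ν hY h0 hy
  have h := measure_forall_notMem ν (measurableSet_sub_le hY y)
    (by rw [hi]; exact ENNReal.add_ne_top.2 ⟨ENNReal.ofReal_ne_top, he⟩)
  rw [hi, ENNReal.toReal_add ENNReal.ofReal_ne_top he, ENNReal.toReal_ofReal hy, neg_add,
    add_comm, Real.exp_add] at h
  rw [← h]
  simp only [Set.mem_ofPred_eq, not_le]

theorem ae_finite_sub_le (hY : Measurable Y) (h0 : ∀ x, 0 ≤ Y x)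
    (he : ∫⁻ x, ENNReal.ofReal (Y x) ∂ν ≠ ∞) :
    ∀ᵐ s ∂markedLaw ν, ∀ M : ℕ, {i | pos s i - Y (s i).2 ≤ M}.Finite := by
  rw [ae_all_iff]
  intro M
  exact ae_finite_of_intensity_ne_top ν (measurableSet_sub_le hY M)
    (by rw [intensity_sub_le ν hY h0 M.cast_nonneg]
        exact ENNReal.add_ne_top.2 ⟨ENNReal.ofReal_ne_top, he⟩)

theorem lintegral_exp_neg_Ioi : ∫⁻ y in Set.Ioi 0, ENNReal.ofReal (Real.exp (-y)) = 1 := by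
  have h := lintegral_expMeasure_one (f := 1) measurable_one
  rw [Measure.restrict_congr_set Ioi_ae_eq_Ici]
  simpa using h.symm

/-- A message computed from independent messages of mean `m` has mean `exp (-m)`. -/
theorem lintegral_shiftedMin (hY : Measurable Y) (h0 : ∀ x, 0 ≤ Y x)
    (he : ∫⁻ x, ENNReal.ofReal (Y x) ∂ν ≠ ∞) :
    ∫⁻ s, ENNReal.ofReal (shiftedMin Y s) ∂markedLaw ν =
      ENNReal.ofReal (Real.exp (-(∫⁻ x, ENNReal.ofReal (Y x) ∂ν).toReal)) := by
  have hm := (measurable_shiftedMin hY).aemeasurable (μ := markedLaw ν)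
  have hn := Filter.Eventually.of_forall (f := ae (markedLaw ν)) (shiftedMin_nonneg Y)
  have hmid : ∫⁻ y in Set.Ioi 0, markedLaw ν {s | ∀ i, y < pos s i - Y (s i).2} =
      ENNReal.ofReal (Real.exp (-(∫⁻ x, ENNReal.ofReal (Y x) ∂ν).toReal)) := by
    rw [setLIntegral_congr_fun measurableSet_Ioi
      fun y hy => measure_forall_lt_sub ν hY h0 he (le_of_lt hy)]
    simp_rw [ENNReal.ofReal_mul (Real.exp_nonneg _)]
    rw [lintegral_const_mul _ (by fun_prop), lintegral_exp_neg_Ioi, mul_one]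
  refine le_antisymm ?_ ?_
  · rw [lintegral_eq_lintegral_meas_lt _ hn hm, ← hmid]
    refine setLIntegral_mono' measurableSet_Ioi fun y hy => measure_mono fun s hs i => ?_
    have h1 := lt_of_lt_of_le hs (ciInf_le (bddBelow_shiftedMin Y s) i)
    exact (lt_max_iff.1 h1).resolve_right (not_lt.2 (le_of_lt hy))
  · rw [lintegral_eq_lintegral_meas_le _ hn hm, ← hmid]
    exact setLIntegral_mono' measurableSet_Ioi fun y hy => measure_mono fun s hs =>
      le_ciInf fun i => le_max_of_le_left (hs i).le

end ShiftedMin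

/-! ### The field of the gaps -/

/-- The law of the field of the gaps, indexed by a vertex and the rank of one of its children. -/
def gapLaw : Measure (Word × ℕ → ℝ) := Measure.infinitePi fun _ => expMeasure 1

instance : IsProbabilityMeasure gapLaw := by unfold gapLaw; infer_instance

/-- The gaps in the subtree of the descendants of `w`. -/
def subtree (w : Word) (g : Word × ℕ → ℝ) : Word × ℕ → ℝ := fun p => g (p.1 ++ w, p.2)

/-- The decomposition of the field at the root: the gaps between the edges at the root, each of
them marked by the field in the subtree of the corresponding child. -/
def branches (g : Word × ℕ → ℝ) : ℕ → ℝ × (Word × ℕ → ℝ) := fun i => (g ([], i), subtree [i] g)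

@[fun_prop]
theorem measurable_subtree (w : Word) : Measurable (subtree w) := by unfold subtree; fun_prop

@[fun_prop]
theorem measurable_branches : Measurable branches := by unfold branches; fun_prop

theorem subtree_subtree (v w : Word) (g : Word × ℕ → ℝ) :
    subtree v (subtree w g) = subtree (v ++ w) g := by
  funext p
  simp [subtree, List.append_assoc]

theorem infinitePi_option {α X : Type*} [MeasurableSpace X] (ρ : Measure X)
    [IsProbabilityMeasure ρ] :
    (Measure.infinitePi fun _ : Option α => ρ).map (fun x => (x none, fun a => x (some a))) =
      ρ.prod (Measure.infinitePi fun _ : α => ρ) := by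
  have hm : Measurable fun p : X × (α → X) => fun o : Option α => o.elim p.1 p.2 := by
    refine measurable_pi_lambda _ fun o => ?_
    cases o
    · exact measurable_fst
    · exact (measurable_pi_apply _).comp measurable_snd
  have h : Measure.infinitePi (fun _ : Option α => ρ) =
      (ρ.prod (Measure.infinitePi fun _ : α => ρ)).map fun p o => o.elim p.1 p.2 := by
    classical
    symm
    refine Measure.eq_infinitePi _ fun F t ht => ?_
    set G := Finset.insertNone (Finset.eraseNone F) with hG
    have hFG : F ⊆ G := by rw [hG, Finset.insertNone_eraseNone]; exact Finset.subset_insert _ _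
    set t' : Option α → Set X := fun i => if i ∈ F then t i else Set.univ with ht'
    have ht'm : ∀ i, MeasurableSet (t' i) := fun i => by
      simp only [ht']; split_ifs; exacts [ht i, MeasurableSet.univ]
    have hprod : ∏ i ∈ F, ρ (t i) = ∏ i ∈ G, ρ (t' i) := by
      rw [← Finset.prod_subset hFG (f := fun i => ρ (t' i))]
      · exact Finset.prod_congr rfl fun i hi => by simp [ht', hi]
      · intro i _ hi; simp [ht', hi]
    have hpre : (fun p : X × (α → X) => fun o : Option α => o.elim p.1 p.2) ⁻¹'
        ((F : Set (Option α)).pi t) =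
        t' none ×ˢ ((Finset.eraseNone F : Set α).pi fun i => t' (some i)) := by
      ext p
      simp only [Set.mem_preimage, Set.mem_pi, Finset.mem_coe, Set.mem_prod, ht',
        Finset.mem_eraseNone]
      constructor
      · intro h
        refine ⟨?_, fun i hi => ?_⟩
        · split_ifs with h0
          exacts [h none h0, trivial]
        · rw [if_pos hi]; exact h (some i) hi
      · rintro ⟨h0, h⟩ i hi
        cases i with
        | none => rwa [if_pos hi] at h0
        | some i => have := h i hi; rwa [if_pos hi] at this
    rw [hprod, Measure.map_apply hm (MeasurableSet.pi (Finset.countable_toSet _) fun i _ => ht i),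
      hpre, Measure.prod_prod, Measure.infinitePi_pi _ fun i _ => ht'm _, hG,
      Finset.prod_insertNone]
  rw [h, Measure.map_map (by fun_prop) hm]
  exact Measure.map_id

/-- The restrictions of the field to disjoint sets of coordinates are independent. -/
theorem map_gapLaw_of_injective {ι κ : Type*} {f : ι × κ → Word × ℕ}
    (hf : Function.Injective f) :
    gapLaw.map (fun g i k => g (f (i, k))) =
      Measure.infinitePi fun _ : ι => Measure.infinitePi fun _ : κ => expMeasure 1 := by
  have h1 := Measure.map_infinitePi_infinitePi_of_inj (P := fun _ : Word × ℕ => expMeasure 1) hf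
  have h2 := Measure.infinitePi_map_curry (fun (_ : ι) (_ : κ) => expMeasure 1)
  rw [← h1, Measure.map_map (by fun_prop) (by fun_prop)] at h2
  exact h2

theorem map_subtree_gapLaw (w : Word) : gapLaw.map (subtree w) = gapLaw := by
  refine Measure.map_infinitePi_infinitePi_of_inj (P := fun _ : Word × ℕ => expMeasure 1)
    (f := fun p : Word × ℕ => (p.1 ++ w, p.2)) ?_
  rintro ⟨u, i⟩ ⟨v, j⟩ h
  simpa using h

theorem map_branches_gapLaw : gapLaw.map branches = markedLaw gapLaw := by
  set f : ℕ × Option (Word × ℕ) → Word × ℕ :=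
    fun p => p.2.elim ([], p.1) fun q => (q.1 ++ [p.1], q.2) with hf
  have hinj : Function.Injective f := by
    rintro ⟨i, _ | ⟨u, k⟩⟩ ⟨j, _ | ⟨v, l⟩⟩ h
    · simpa [hf] using h
    · simp [hf] at h
    · simp [hf] at h
    · simp only [hf, Option.elim_some, Prod.mk.injEq] at h
      obtain ⟨h1, rfl⟩ := h
      obtain ⟨rfl, h2⟩ := List.append_inj' h1 rfl
      simp_all
  have h := congrArg (Measure.map fun x i => ((x i none, fun a => x i (some a)) :
    ℝ × (Word × ℕ → ℝ))) (map_gapLaw_of_injective hinj)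
  rw [Measure.map_map (by fun_prop) (by fun_prop), Measure.infinitePi_map_pi
    (f := fun (_ : ℕ) (x : Option (Word × ℕ) → ℝ) => (x none, fun a => x (some a)))
    _ (by fun_prop)] at h
  simp only [infinitePi_option] at h
  exact h

theorem ae_subtree {p : (Word × ℕ → ℝ) → Prop} (h : ∀ᵐ g ∂gapLaw, p g) :
    ∀ᵐ g ∂gapLaw, ∀ w, p (subtree w g) := by
  rw [ae_all_iff]
  intro w
  rw [← map_subtree_gapLaw w] at h
  exact ae_of_ae_map (by fun_prop) h

theorem ae_branches {p : (ℕ → ℝ × (Word × ℕ → ℝ)) → Prop} (h : ∀ᵐ s ∂markedLaw gapLaw, p s) :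
    ∀ᵐ g ∂gapLaw, p (branches g) := by
  rw [← map_branches_gapLaw] at h
  exact ae_of_ae_map (by fun_prop) h

/-! ### Edge lengths as functions of the gaps -/

/-- The undirected edges, indexed by the endpoint nearer to the root and the rank of the other
endpoint. -/
def edgeEquiv : Word × ℕ ≃ Edge :=
  Equiv.ofBijective (fun p => und (down p.1 p.2)) (by
    constructor
    · rintro ⟨v, i⟩ ⟨w, j⟩ h
      rcases und_eq_und_iff.1 h with h | h
      · have h1 : v = w := congrArg (fun d : DirEdge => d.fst) h
        have h2 : i :: v = j :: w := congrArg (fun d : DirEdge => d.snd) h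
        exact Prod.ext h1 (List.cons.inj h2).1
      · have h1 : v = j :: w := congrArg (fun d : DirEdge => d.fst) h
        have h2 : i :: v = w := congrArg (fun d : DirEdge => d.snd) h
        have := congrArg List.length (h1.trans (congrArg (List.cons j) h2.symm))
        simp at this
        omega
    · rintro ⟨e, he⟩
      induction e using Sym2.ind with
      | _ u v =>
        obtain ⟨w, i, h | h⟩ := eq_down_or_eq_symm_down ⟨(u, v), he⟩
        · exact ⟨(w, i), (congrArg und h).symm⟩
        · exact ⟨(w, i), ((congrArg und h).trans (und_symm _)).symm⟩)

/-- The edge lengths given by a function on `Word × ℕ`. -/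
def ofLengths (l : Word × ℕ → ℝ) (e : Edge) : ℝ := l (edgeEquiv.symm e)

theorem ofLengths_und_down (l : Word × ℕ → ℝ) (v : Word) (i : ℕ) :
    ofLengths l (und (down v i)) = l (v, i) :=
  congrArg l (edgeEquiv.symm_apply_apply (v, i))

theorem edge_eq_und_down (e : Edge) : ∃ v i, e = und (down v i) :=
  ⟨_, _, (edgeEquiv.apply_symm_apply e).symm⟩

/-- The lengths of the edges are the partial sums of the gaps at each vertex. -/
def lengths (g : Word × ℕ → ℝ) (p : Word × ℕ) : ℝ := ∑ j ∈ Finset.range (p.2 + 1), g (p.1, j)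

/-- The edge lengths as a function of the field of the gaps. -/
def edgeLengths (g : Word × ℕ → ℝ) : Edge → ℝ := ofLengths (lengths g)

@[fun_prop]
theorem measurable_ofLengths : Measurable ofLengths := by unfold ofLengths; fun_prop

@[fun_prop]
theorem measurable_lengths : Measurable lengths := by unfold lengths; fun_prop

@[fun_prop]
theorem measurable_edgeLengths : Measurable edgeLengths := by unfold edgeLengths; fun_prop

theorem edgeLengths_und_down (g : Word × ℕ → ℝ) (v : Word) (i : ℕ) :
    edgeLengths g (und (down v i)) = lengths g (v, i) := ofLengths_und_down _ _ _

theorem lengths_eq_pos (g : Word × ℕ → ℝ) (v : Word) (i : ℕ) :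
    lengths g (v, i) = pos (branches (subtree v g)) i := rfl

theorem gap_edgeLengths (g : Word × ℕ → ℝ) (v : Word) (i : ℕ) :
    gap (edgeLengths g) v i = g (v, i) := by
  cases i with
  | zero => simp [gap, edgeLengths_und_down, lengths]
  | succ i => simp [gap, edgeLengths_und_down, lengths, Finset.sum_range_succ _ (i + 1)]

theorem edgeLengths_gap (ℓ : Edge → ℝ) : edgeLengths (fun p => gap ℓ p.1 p.2) = ℓ := by
  funext e
  obtain ⟨v, i, rfl⟩ := edge_eq_und_down e
  rw [edgeLengths_und_down, lengths]
  induction i with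
  | zero => simp [gap]
  | succ i ih =>
    rw [Finset.sum_range_succ]
    dsimp only at ih ⊢
    rw [ih, gap]
    ring

theorem measurable_gap (v : Word) (i : ℕ) : Measurable fun ℓ : Edge → ℝ => gap ℓ v i := by
  cases i <;> simp only [gap] <;> fun_prop

theorem IsPWIT.map_gap {Ω : Type*} [MeasurableSpace Ω] {P : Measure Ω} {ξ : Ω → Edge → ℝ}
    (h : IsPWIT P ξ) : P.map (fun ω (p : Word × ℕ) => gap (ξ ω) p.1 p.2) = gapLaw := by
  have hm : ∀ p : Word × ℕ, Measurable fun ω => gap (ξ ω) p.1 p.2 := fun p =>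
    (measurable_gap _ _).comp h.measurable
  rw [h.indep.map_fun_eq_infinitePi_map hm, gapLaw]
  exact congrArg _ (funext fun p => h.law _ _)

/-- The edge lengths of a PWIT all have the same law. -/
theorem IsPWIT.map_eq {Ω : Type*} [MeasurableSpace Ω] {P : Measure Ω} {ξ : Ω → Edge → ℝ}
    (h : IsPWIT P ξ) : P.map ξ = gapLaw.map edgeLengths := by
  have hm : Measurable fun ω (p : Word × ℕ) => gap (ξ ω) p.1 p.2 :=
    measurable_pi_lambda _ fun p => (measurable_gap _ _).comp h.measurable
  rw [← h.map_gap, Measure.map_map (by fun_prop) hm]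
  exact congrArg (P.map ·) (funext fun ω => (edgeLengths_gap _).symm)

theorem IsPWIT.ae {Ω : Type*} [MeasurableSpace Ω] {P : Measure Ω} {ξ : Ω → Edge → ℝ}
    (h : IsPWIT P ξ) {p : (Edge → ℝ) → Prop} (hp : ∀ᵐ g ∂gapLaw, p (edgeLengths g)) :
    ∀ᵐ ω ∂P, p (ξ ω) := by
  have hm : Measurable fun ω (p : Word × ℕ) => gap (ξ ω) p.1 p.2 :=
    measurable_pi_lambda _ fun p => (measurable_gap _ _).comp h.measurable
  rw [← h.map_gap] at hp
  filter_upwards [ae_of_ae_map hm.aemeasurable hp] with ω hω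
  rwa [edgeLengths_gap] at hω

theorem IsPWIT.lintegral_eq {Ω : Type*} [MeasurableSpace Ω] {P : Measure Ω} {ξ : Ω → Edge → ℝ}
    (h : IsPWIT P ξ) {F : (Edge → ℝ) → ℝ≥0∞} (hF : Measurable F) :
    ∫⁻ ω, F (ξ ω) ∂P = ∫⁻ g, F (edgeLengths g) ∂gapLaw := by
  rw [← lintegral_map hF h.measurable, h.map_eq, lintegral_map hF (by fun_prop)]

theorem isPWIT_edgeLengths : IsPWIT gapLaw edgeLengths where
  measurable := by fun_prop
  indep := by
    simp only [gap_edgeLengths]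
    exact iIndepFun_infinitePi (X := fun _ x => x) fun _ => measurable_id
  law v i := by
    simp only [gap_edgeLengths]
    exact Measure.infinitePi_map_eval (fun _ : Word × ℕ => expMeasure 1) (v, i)

/-! ### Convergence of the iterated messages -/

/-- The `n`-th iterate of the recursion on the edge that leads to the root of a tree, as a function
of the gaps in the tree. -/
def mess : ℕ → (Word × ℕ → ℝ) → ℝ
  | 0 => 0
  | n + 1 => fun g => shiftedMin (mess n) (branches g)

@[fun_prop]
theorem measurable_mess (n : ℕ) : Measurable (mess n) := by
  induction n with
  | zero => exact measurable_const
  | succ n ih => exact (measurable_shiftedMin ih).comp measurable_branches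

theorem mess_nonneg (n : ℕ) (g : Word × ℕ → ℝ) : 0 ≤ mess n g := by
  cases n with
  | zero => exact le_rfl
  | succ n => exact shiftedMin_nonneg _ _

theorem mem_next_down {v : Word} {i : ℕ} {d : DirEdge} :
    d ∈ next (down v i) ↔ ∃ j, d = down (i :: v) j := by
  constructor
  · rintro ⟨h1, h2⟩
    obtain ⟨w, j, rfl | rfl⟩ := eq_down_or_eq_symm_down d
    · have h1 : w = i :: v := h1
      exact ⟨j, by rw [h1]⟩
    · have h1 : j :: w = i :: v := h1
      exact absurd (List.cons.inj h1).2 h2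
  · rintro ⟨j, rfl⟩
    refine ⟨rfl, fun h => ?_⟩
    have := congrArg List.length h
    simp [down] at this
    omega

theorem iInf_next_down (f : DirEdge → ℝ) (v : Word) (i : ℕ) :
    ⨅ d : next (down v i), f d = ⨅ j, f (down (i :: v) j) := by
  refine (Function.Surjective.iInf_comp
    (f := fun j => (⟨down (i :: v) j, mem_next_down.2 ⟨j, rfl⟩⟩ : next (down v i)))
    ?_ fun d => f d).symm
  rintro ⟨d, hd⟩
  obtain ⟨j, rfl⟩ := mem_next_down.1 hd
  exact ⟨j, rfl⟩

theorem iter_down (g : Word × ℕ → ℝ) (n : ℕ) (v : Word) (i : ℕ) :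
    iter (edgeLengths g) n (down v i) = mess n (subtree (i :: v) g) := by
  induction n generalizing v i with
  | zero => rfl
  | succ n ih =>
    change update _ _ _ = shiftedMin _ _
    rw [update, iInf_next_down, shiftedMin]
    refine iInf_congr fun j => ?_
    rw [reduced, ih, edgeLengths_und_down, lengths_eq_pos, branches, subtree_subtree]
    rfl

/-- The limit of the odd iterates on the edge that leads to the root of a tree. -/
def messUpper (g : Word × ℕ → ℝ) : ℝ := ⨅ k : ℕ, mess (2 * k + 1) g

/-- The limit of the even iterates on the edge that leads to the root of a tree. -/
def messLower (g : Word × ℕ → ℝ) : ℝ := ⨆ k : ℕ, mess (2 * k) g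

@[fun_prop]
theorem measurable_messUpper : Measurable messUpper := Measurable.iInf fun _ => measurable_mess _

@[fun_prop]
theorem measurable_messLower : Measurable messLower := Measurable.iSup fun _ => measurable_mess _

theorem upper_down (g : Word × ℕ → ℝ) (v : Word) (i : ℕ) :
    upper (edgeLengths g) (down v i) = messUpper (subtree (i :: v) g) := by
  simp only [upper, messUpper, iter_down]

theorem lower_down (g : Word × ℕ → ℝ) (v : Word) (i : ℕ) :
    lower (edgeLengths g) (down v i) = messLower (subtree (i :: v) g) := by
  simp only [lower, messLower, iter_down]

theorem messUpper_nonneg (g : Word × ℕ → ℝ) : 0 ≤ messUpper g :=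
  le_ciInf fun _ => mess_nonneg _ _

/-- Every field is the restriction of a larger one to a subtree, so that facts about the messages on
the edges of the tree apply to `mess`. -/
theorem subtree_surjective (w : Word) : Function.Surjective (subtree w) := by
  intro g
  refine ⟨fun p => g (p.1.take (p.1.length - w.length), p.2), funext fun p => ?_⟩
  simp [subtree]

theorem messLower_le_messUpper (g : Word × ℕ → ℝ) : messLower g ≤ messUpper g := by
  obtain ⟨g, rfl⟩ := subtree_surjective [0] g
  rw [← lower_down, ← upper_down]
  exact lower_le_upper _

theorem messUpper_le_mess (k : ℕ) (g : Word × ℕ → ℝ) : messUpper g ≤ mess (2 * k + 1) g := by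
  obtain ⟨g, rfl⟩ := subtree_surjective [0] g
  rw [← iter_down, ← upper_down]
  exact upper_le_iter_odd k _

theorem mess_le_messLower (k : ℕ) (g : Word × ℕ → ℝ) : mess (2 * k) g ≤ messLower g := by
  obtain ⟨g, rfl⟩ := subtree_surjective [0] g
  rw [← iter_down, ← lower_down]
  exact iter_even_le_lower k _

/-- The means of the iterated messages. -/
def messMean : ℕ → ℝ
  | 0 => 0
  | n + 1 => Real.exp (-messMean n)

theorem messMean_nonneg (n : ℕ) : 0 ≤ messMean n := by
  cases n with
  | zero => exact le_rfl
  | succ n => exact (Real.exp_pos _).le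

theorem lintegral_mess (n : ℕ) :
    ∫⁻ g, ENNReal.ofReal (mess n g) ∂gapLaw = ENNReal.ofReal (messMean n) := by
  induction n with
  | zero => simp [mess, messMean]
  | succ n ih =>
    have h := lintegral_shiftedMin gapLaw (measurable_mess n) (mess_nonneg n)
      (by rw [ih]; exact ENNReal.ofReal_ne_top)
    rw [ih, ENNReal.toReal_ofReal (messMean_nonneg n), ← map_branches_gapLaw,
      lintegral_map (measurable_shiftedMin (measurable_mess n)).ennreal_ofReal (by fun_prop)] at h
    exact h

theorem exp_neg_one_le_messMean (n : ℕ) : Real.exp (-1) ≤ messMean (n + 1) := by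
  refine Real.exp_le_exp.2 (neg_le_neg ?_)
  cases n with
  | zero => exact zero_le_one
  | succ n => exact Real.exp_le_one_iff.2 (neg_nonpos.2 (messMean_nonneg n))

theorem abs_exp_neg_sub_exp_neg_le {a x y : ℝ} (hx : a ≤ x) (hy : a ≤ y) :
    |Real.exp (-x) - Real.exp (-y)| ≤ Real.exp (-a) * |x - y| := by
  wlog hxy : x ≤ y generalizing x y
  · rw [abs_sub_comm, abs_sub_comm x]
    exact this hy hx (le_of_not_ge hxy)
  have h1 : 1 - (y - x) ≤ Real.exp (-(y - x)) := by
    linarith [Real.add_one_le_exp (-(y - x))]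
  have h2 : Real.exp (-y) = Real.exp (-x) * Real.exp (-(y - x)) := by
    rw [← Real.exp_add]; ring_nf
  have h3 : Real.exp (-y) ≤ Real.exp (-x) := Real.exp_le_exp.2 (by linarith)
  have h4 : Real.exp (-x) ≤ Real.exp (-a) := Real.exp_le_exp.2 (by linarith)
  rw [abs_of_nonneg (by linarith), abs_sub_comm, abs_of_nonneg (by linarith)]
  nlinarith [Real.exp_pos (-x)]

/-- The map `x ↦ exp (-x)` is a contraction on the interval that contains its iterates. -/
theorem tendsto_messMean_sub :
    Filter.Tendsto (fun n => |messMean (n + 1) - messMean n|) Filter.atTop (nhds 0) := by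
  have hb : ∀ n, |messMean (n + 2) - messMean (n + 1)| ≤
      Real.exp (-Real.exp (-1)) ^ n * |messMean 2 - messMean 1| := by
    intro n
    induction n with
    | zero => simp
    | succ n ih =>
      refine (abs_exp_neg_sub_exp_neg_le (exp_neg_one_le_messMean (n + 1))
        (exp_neg_one_le_messMean n)).trans ?_
      rw [pow_succ', mul_assoc]
      exact mul_le_mul_of_nonneg_left ih (Real.exp_pos _).le
  rw [← Filter.tendsto_add_atTop_iff_nat 1]
  refine squeeze_zero (fun _ => abs_nonneg _) hb ?_
  have h1 : Real.exp (-Real.exp (-1)) < 1 :=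
    Real.exp_lt_one_iff.2 (neg_lt_zero.2 (Real.exp_pos _))
  simpa using (tendsto_pow_atTop_nhds_zero_of_lt_one (Real.exp_pos _).le h1).mul_const
    |messMean 2 - messMean 1|

theorem lintegral_messUpper_ne_top : ∫⁻ g, ENNReal.ofReal (messUpper g) ∂gapLaw ≠ ∞ := by
  refine ne_top_of_le_ne_top (ENNReal.ofReal_ne_top (r := messMean 1)) ?_
  rw [← lintegral_mess]
  exact lintegral_mono fun g => ENNReal.ofReal_le_ofReal (messUpper_le_mess 0 g)

/-- The even and the odd iterates have the same limit, because their means do. -/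
theorem ae_messLower_eq_messUpper : ∀ᵐ g ∂gapLaw, messLower g = messUpper g := by
  have hle : ∫⁻ g, ENNReal.ofReal (messUpper g) ∂gapLaw ≤
      ∫⁻ g, ENNReal.ofReal (messLower g) ∂gapLaw := by
    have hk : ∀ k : ℕ, ∫⁻ g, ENNReal.ofReal (messUpper g) ∂gapLaw ≤
        ∫⁻ g, ENNReal.ofReal (messLower g) ∂gapLaw +
          ENNReal.ofReal |messMean (2 * k + 1) - messMean (2 * k)| := by
      intro k
      calc ∫⁻ g, ENNReal.ofReal (messUpper g) ∂gapLaw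
          ≤ ENNReal.ofReal (messMean (2 * k + 1)) := by
            rw [← lintegral_mess]
            exact lintegral_mono fun g => ENNReal.ofReal_le_ofReal (messUpper_le_mess k g)
        _ ≤ ENNReal.ofReal (messMean (2 * k)) +
              ENNReal.ofReal |messMean (2 * k + 1) - messMean (2 * k)| := by
            rw [← ENNReal.ofReal_add (messMean_nonneg _) (abs_nonneg _)]
            have := le_abs_self (messMean (2 * k + 1) - messMean (2 * k))
            exact ENNReal.ofReal_le_ofReal (by linarith)
        _ ≤ _ := by
            rw [← lintegral_mess]
            gcongr with g
            exact mess_le_messLower k g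
    refine ge_of_tendsto' (f := fun k : ℕ => ∫⁻ g, ENNReal.ofReal (messLower g) ∂gapLaw +
      ENNReal.ofReal |messMean (2 * k + 1) - messMean (2 * k)|) (x := Filter.atTop) ?_ hk
    have h1 := (ENNReal.tendsto_ofReal (tendsto_messMean_sub.comp
      (Filter.tendsto_id.const_mul_atTop' (r := 2) two_pos))).const_add
      (∫⁻ g, ENNReal.ofReal (messLower g) ∂gapLaw)
    simpa using h1
  have hae := ae_eq_of_ae_le_of_lintegral_le (μ := gapLaw)
    (f := fun g => ENNReal.ofReal (messLower g)) (g := fun g => ENNReal.ofReal (messUpper g))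
    (Filter.Eventually.of_forall fun g => ENNReal.ofReal_le_ofReal (messLower_le_messUpper g))
    (ne_top_of_le_ne_top lintegral_messUpper_ne_top
      (lintegral_mono fun g => ENNReal.ofReal_le_ofReal (messLower_le_messUpper g)))
    (by fun_prop) hle
  filter_upwards [hae] with g hg
  exact (ENNReal.ofReal_eq_ofReal_iff (mess_le_messLower 0 g) (messUpper_nonneg g)).1 hg

theorem ae_lower_down_eq_upper_down : ∀ᵐ g ∂gapLaw, ∀ v i,
    lower (edgeLengths g) (down v i) = upper (edgeLengths g) (down v i) := by
  filter_upwards [ae_subtree ae_messLower_eq_messUpper] with g hg v i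
  rw [lower_down, upper_down, hg]

theorem ae_locallyFinite : ∀ᵐ g ∂gapLaw, LocallyFinite (edgeLengths g) := by
  have h := ae_finite_sub_le gapLaw (measurable_mess 1) (mess_nonneg 1)
    (by rw [lintegral_mess]; exact ENNReal.ofReal_ne_top)
  filter_upwards [ae_subtree (ae_branches h)] with g hg v M
  have hup : {d : DirEdge | ∃ w i, v = i :: w ∧ d = (down w i).symm}.Finite := by
    refine Set.Subsingleton.finite ?_
    rintro _ ⟨w, i, h, rfl⟩ _ ⟨w', i', h', rfl⟩
    obtain ⟨rfl, rfl⟩ := List.cons.inj (h.symm.trans h')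
    rfl
  refine (((hg v M).image (down v)).union hup).subset ?_
  rintro d ⟨hv, hd⟩
  obtain ⟨w, i, rfl | rfl⟩ := eq_down_or_eq_symm_down d
  · obtain rfl : w = v := hv
    refine Or.inl ⟨i, ?_, rfl⟩
    rw [edgeLengths_und_down, lengths_eq_pos, iter_down] at hd
    simpa [branches, subtree_subtree] using hd
  · exact Or.inr ⟨w, i, hv.symm, rfl⟩

theorem ae_isSolution_upper :
    ∀ᵐ g ∂gapLaw, IsSolution (edgeLengths g) (upper (edgeLengths g)) := by
  filter_upwards [ae_locallyFinite, ae_lower_down_eq_upper_down] with g h1 h2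
  exact h1.isSolution_upper h2

/-- On a PWIT, the message recursion almost surely has exactly one solution, which is a function of
the edge lengths. -/
theorem IsPWIT.ae_isSolution_iff {Ω : Type*} [MeasurableSpace Ω] {P : Measure Ω}
    {ξ : Ω → Edge → ℝ} (h : IsPWIT P ξ) :
    ∀ᵐ ω ∂P, ∀ x, IsSolution (ξ ω) x ↔ x = upper (ξ ω) := by
  refine h.ae (p := fun ℓ => ∀ x, IsSolution ℓ x ↔ x = upper ℓ) ?_
  filter_upwards [ae_locallyFinite, ae_lower_down_eq_upper_down] with g h1 h2 x
  refine ⟨fun hx => hx.eq_upper (h1.lower_eq_upper h2), ?_⟩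
  rintro rfl
  exact h1.isSolution_upper h2

/-! ### Automorphisms of the tree -/

/-- The tree automorphism given by a permutation of the words that respects adjacency. -/
def isoOfAdj (e : Word ≃ Word) (h : ∀ v i, tree.Adj (e v) (e (i :: v)))
    (h' : ∀ v i, tree.Adj (e.symm v) (e.symm (i :: v))) : tree ≃g tree where
  toEquiv := e
  map_rel_iff' := by
    have key : ∀ f : Word → Word, (∀ v i, tree.Adj (f v) (f (i :: v))) →
        ∀ u v, tree.Adj u v → tree.Adj (f u) (f v) := by
      rintro f hf u v (⟨i, rfl⟩ | ⟨i, rfl⟩)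
      exacts [hf u i, (hf v i).symm]
    intro u v
    exact ⟨fun huv => by simpa using key e.symm h' _ _ huv, key e h u v⟩

/-- Replacing the first letter `j` of a word (which is stored last) by `f j`. -/
def relabelWord (f : ℕ → ℕ) (v : Word) : Word :=
  match v.getLast? with
  | none => []
  | some j => v.dropLast ++ [f j]

@[simp]
theorem relabelWord_nil (f : ℕ → ℕ) : relabelWord f [] = [] := rfl

@[simp]
theorem relabelWord_append (f : ℕ → ℕ) (v : Word) (j : ℕ) :
    relabelWord f (v ++ [j]) = v ++ [f j] := by
  simp [relabelWord]

theorem relabelWord_adj (f : ℕ → ℕ) (v : Word) (i : ℕ) :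
    tree.Adj (relabelWord f v) (relabelWord f (i :: v)) := by
  rcases List.eq_nil_or_concat v with rfl | ⟨w, j, rfl⟩
  · rw [show ([i] : Word) = [] ++ [i] from rfl, relabelWord_append]
    exact adj_child [] (f i)
  · rw [List.concat_eq_append, relabelWord_append, ← List.cons_append, relabelWord_append]
    exact adj_child _ i

/-- The tree automorphism that permutes the subtrees at the root. -/
def relabel (π : Equiv.Perm ℕ) : tree ≃g tree :=
  isoOfAdj
    { toFun := relabelWord π
      invFun := relabelWord π.symm
      left_inv := fun v => by
        rcases List.eq_nil_or_concat v with rfl | ⟨w, j, rfl⟩ <;> simp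
      right_inv := fun v => by
        rcases List.eq_nil_or_concat v with rfl | ⟨w, j, rfl⟩ <;> simp }
    (relabelWord_adj π) (relabelWord_adj π.symm)

/-- The map underlying `swap`. -/
def swapWord (v : Word) : Word :=
  match v.getLast? with
  | none => [0]
  | some 0 => relabelWord Nat.succ v.dropLast
  | some (j + 1) => v.dropLast ++ [j] ++ [0]

@[simp]
theorem swapWord_append_zero (v : Word) : swapWord (v ++ [0]) = relabelWord Nat.succ v := by
  simp [swapWord]

@[simp]
theorem swapWord_append_succ (v : Word) (j : ℕ) :
    swapWord (v ++ [j + 1]) = v ++ [j] ++ [0] := by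
  simp [swapWord]

theorem swapWord_swapWord (v : Word) : swapWord (swapWord v) = v := by
  rcases List.eq_nil_or_concat v with rfl | ⟨w, j, rfl⟩
  · exact swapWord_append_zero []
  rw [List.concat_eq_append]
  cases j with
  | zero =>
    rw [swapWord_append_zero]
    rcases List.eq_nil_or_concat w with rfl | ⟨u, j, rfl⟩
    · rfl
    · rw [List.concat_eq_append, relabelWord_append, swapWord_append_succ]
  | succ j => rw [swapWord_append_succ, swapWord_append_zero, relabelWord_append]

theorem swapWord_adj (v : Word) (i : ℕ) : tree.Adj (swapWord v) (swapWord (i :: v)) := by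
  rcases List.eq_nil_or_concat v with rfl | ⟨w, j, rfl⟩
  · rw [show ([i] : Word) = [] ++ [i] from rfl]
    cases i with
    | zero => rw [swapWord_append_zero]; exact (adj_child [] 0).symm
    | succ i => rw [swapWord_append_succ]; exact adj_child [0] i
  rw [List.concat_eq_append, ← List.cons_append]
  cases j with
  | zero => rw [swapWord_append_zero, swapWord_append_zero]; exact relabelWord_adj _ w i
  | succ j => rw [swapWord_append_succ, swapWord_append_succ]; exact adj_child _ i

/-- The involutive tree automorphism that exchanges the root with its first child, and the
remaining subtrees at the root with the subtrees at the first child. -/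
def swap : tree ≃g tree :=
  isoOfAdj ⟨swapWord, swapWord, swapWord_swapWord, swapWord_swapWord⟩ swapWord_adj swapWord_adj

/-- The lengths on the tree whose edges at the root have lengths `r i`, and whose subtrees at the
children of the root carry the lengths `t i`. -/
def graft (r : ℕ → ℝ) (t : ℕ → Word × ℕ → ℝ) (p : Word × ℕ) : ℝ :=
  match p.1.getLast? with
  | none => r p.2
  | some j => t j (p.1.dropLast, p.2)

@[simp]
theorem graft_nil (r : ℕ → ℝ) (t : ℕ → Word × ℕ → ℝ) (k : ℕ) : graft r t ([], k) = r k := rfl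

@[simp]
theorem graft_append (r : ℕ → ℝ) (t : ℕ → Word × ℕ → ℝ) (v : Word) (j k : ℕ) :
    graft r t (v ++ [j], k) = t j (v, k) := by
  simp [graft]

theorem lengths_eq_graft (g : Word × ℕ → ℝ) :
    lengths g = graft (pos (branches g)) fun i => lengths (branches g i).2 := by
  funext ⟨v, k⟩
  rcases List.eq_nil_or_concat v with rfl | ⟨w, j, rfl⟩
  · rfl
  · rw [List.concat_eq_append, graft_append]
    rfl

theorem ofLengths_und {l : Word × ℕ → ℝ} {d : DirEdge} {v : Word} {i : ℕ} (h1 : d.fst = v)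
    (h2 : d.snd = i :: v) : ofLengths l (und d) = l (v, i) := by
  rw [dirEdge_ext (d' := down v i) h1 h2, ofLengths_und_down]

theorem ofLengths_graft_relabel {r r' : ℕ → ℝ} {t t' : ℕ → Word × ℕ → ℝ} (π : Equiv.Perm ℕ)
    (hr : ∀ i, r' (π i) = r i) (ht : ∀ i, t' (π i) = t i) (e : Edge) :
    ofLengths (graft r' t') ((relabel π).mapEdgeSet e) = ofLengths (graft r t) e := by
  obtain ⟨v, k, rfl⟩ := edge_eq_und_down e
  rw [← und_mapDir, ofLengths_und_down]
  rcases List.eq_nil_or_concat v with rfl | ⟨w, j, rfl⟩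
  · rw [ofLengths_und (v := []) (i := π k) rfl (relabelWord_append π [] k), graft_nil, graft_nil,
      hr]
  · rw [List.concat_eq_append, ofLengths_und (v := w ++ [π j]) (i := k) (relabelWord_append π w j)
      (relabelWord_append π (k :: w) j), graft_append, graft_append, ht]

/-- The lengths on the tree in which the first edge at the root has length `t` and leads to a
subtree with gaps `x`, and the other edges at the root and their subtrees are given by `s`. -/
def merge (t : ℝ) (x : Word × ℕ → ℝ) (s : ℕ → ℝ × (Word × ℕ → ℝ)) : Word × ℕ → ℝ :=
  graft (consSeq t (pos s)) (consSeq (lengths x) fun j => lengths (s j).2)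

theorem measurable_merge : Measurable fun p : ℝ × (Word × ℕ → ℝ) × (ℕ → ℝ × (Word × ℕ → ℝ)) =>
    merge p.1 p.2.1 p.2.2 := by
  refine measurable_pi_lambda _ fun ⟨v, k⟩ => ?_
  rcases List.eq_nil_or_concat v with rfl | ⟨w, j, rfl⟩
  · simp only [merge, graft_nil]
    cases k <;> simp only [consSeq] <;> fun_prop
  · simp only [merge, List.concat_eq_append, graft_append]
    cases j <;> simp only [consSeq, lengths] <;> fun_prop

/-- The permutation that moves `i` to the front. -/
def moveToFront (i : ℕ) : Equiv.Perm ℕ where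
  toFun n := if n = i then 0 else if n < i then n + 1 else n
  invFun n := consSeq i (skip i) n
  left_inv n := by
    rcases lt_trichotomy n i with h | rfl | h
    · simp [h, h.ne, consSeq, skip]
    · simp [consSeq]
    · obtain ⟨m, rfl⟩ := Nat.exists_eq_succ_of_ne_zero (Nat.ne_zero_of_lt h)
      simp only [h.ne', if_false, not_lt.2 h.le, consSeq, skip]
      rw [if_neg (by omega)]
  right_inv n := by
    cases n with
    | zero => simp [consSeq]
    | succ n =>
      simp only [consSeq, skip_ne, if_false]
      unfold skip
      split_ifs <;> omega

theorem apply_moveToFront {α : Type*} {i : ℕ} {f f' : ℕ → α} (h0 : f' 0 = f i)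
    (h : ∀ j, f' (j + 1) = f (skip i j)) (n : ℕ) : f' (moveToFront i n) = f n := by
  obtain ⟨m, rfl⟩ := (moveToFront i).symm.surjective n
  rw [Equiv.apply_symm_apply]
  cases m with
  | zero => exact h0
  | succ m => exact h m

/-- Moving the `i`-th child of the root to the front turns the lengths into a `merge`. -/
theorem ofLengths_merge_relabel (g : Word × ℕ → ℝ) (i : ℕ) (e : Edge) :
    ofLengths (merge (pos (branches g) i) (branches g i).2 (remove i (branches g)))
      ((relabel (moveToFront i)).mapEdgeSet e) = edgeLengths g e := by
  rw [edgeLengths, lengths_eq_graft, merge]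
  refine ofLengths_graft_relabel _ (fun n => ?_) (fun n => ?_) e
  · exact apply_moveToFront (f' := consSeq _ (pos (remove i (branches g))))
      (f := pos (branches g)) rfl (fun j => pos_remove i _ j) n
  · exact apply_moveToFront (f := fun i => lengths (branches g i).2) rfl
      (fun j => congrArg lengths (remove_snd i _ j)) n

/-- Exchanging the two ends of the first edge at the root exchanges the trees at its ends. -/
theorem ofLengths_merge_swap (t : ℝ) (x y : Word × ℕ → ℝ) (e : Edge) :
    ofLengths (merge t y (branches x)) (swap.mapEdgeSet e) =
      ofLengths (merge t x (branches y)) e := by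
  obtain ⟨v, k, rfl⟩ := edge_eq_und_down e
  rw [← und_mapDir, ofLengths_und_down]
  rcases List.eq_nil_or_concat v with rfl | ⟨w, j, rfl⟩
  · cases k with
    | zero =>
      rw [← und_symm, ofLengths_und (v := []) (i := 0) rfl rfl]
      rfl
    | succ k =>
      rw [ofLengths_und (v := [] ++ [0]) (i := k) rfl (swapWord_append_succ [] k), merge,
        graft_append]
      rfl
  rw [List.concat_eq_append]
  cases j with
  | zero =>
    rcases List.eq_nil_or_concat w with rfl | ⟨u, j, rfl⟩
    · rw [ofLengths_und (v := []) (i := k + 1) rfl (swapWord_append_zero [k])]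
      rfl
    · have h1 : swapWord (u ++ [j] ++ [0]) = u ++ [j + 1] := by
        rw [swapWord_append_zero, relabelWord_append]
      have h2 : swapWord (k :: (u ++ [j] ++ [0])) = k :: (u ++ [j + 1]) := by
        rw [← List.cons_append, swapWord_append_zero, ← List.cons_append, relabelWord_append]
        rfl
      rw [List.concat_eq_append, ofLengths_und (v := u ++ [j + 1]) (i := k) h1 h2, merge, merge,
        graft_append, graft_append]
      change _ = lengths x (u ++ [j], k)
      rw [lengths_eq_graft x, graft_append]
      rfl
  | succ j =>
    rw [ofLengths_und (v := w ++ [j] ++ [0]) (i := k) (swapWord_append_succ w j)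
      (swapWord_append_succ (k :: w) j), merge, merge, graft_append, graft_append]
    change lengths y (w ++ [j], k) = _
    rw [lengths_eq_graft y, graft_append]
    rfl

/-! ### Unimodularity of the PWIT -/

/-- The neighbours of the root. -/
def rootNeighborEquiv : ℕ ≃ tree.neighborSet [] :=
  Equiv.ofBijective (fun i => ⟨[i], adj_child [] i⟩) (by
    constructor
    · intro i j h
      simpa using congrArg Subtype.val h
    · rintro ⟨v, ⟨i, rfl⟩ | ⟨i, h⟩⟩
      · exact ⟨i, rfl⟩
      · exact absurd h.symm (List.cons_ne_nil _ _))

theorem tsum_neighborSet_root (f : Word → ℝ≥0∞) :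
    ∑' x : tree.neighborSet [], f x = ∑' i : ℕ, f [i] :=
  (rootNeighborEquiv.tsum_eq fun x : tree.neighborSet [] => f x).symm

/-- The lengths of the edges of a PWIT form a unimodular network: by Mecke's formula, a PWIT with a
distinguished edge at the root is a pair of independent PWITs joined by an edge whose length is
distributed according to Lebesgue measure, and this description is symmetric. -/
theorem lintegral_gapLaw_involution {F : (Edge → ℝ) → Word → Word → ℝ≥0∞}
    (hF : ∀ o x, Measurable fun ℓ => F ℓ o x)
    (hiso : ∀ (γ : tree ≃g tree) (ℓ ℓ' : Edge → ℝ), (∀ e, ℓ' (γ.mapEdgeSet e) = ℓ e) →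
      ∀ o x, F ℓ' (γ o) (γ x) = F ℓ o x) :
    ∫⁻ g, ∑' i : ℕ, F (edgeLengths g) [] [i] ∂gapLaw =
      ∫⁻ g, ∑' i : ℕ, F (edgeLengths g) [i] [] ∂gapLaw := by
  have hH : ∀ o x, Measurable fun p : ℝ × (Word × ℕ → ℝ) × (ℕ → ℝ × (Word × ℕ → ℝ)) =>
      F (ofLengths (merge p.1 p.2.1 p.2.2)) o x := fun o x =>
    (hF o x).comp (measurable_ofLengths.comp measurable_merge)
  have hHb : ∀ o x, Measurable fun p : ((Word × ℕ → ℝ) × ℝ) × (Word × ℕ → ℝ) =>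
      F (ofLengths (merge p.1.2 p.2 (branches p.1.1))) o x := fun o x =>
    (hH o x).comp (f := fun p : ((Word × ℕ → ℝ) × ℝ) × (Word × ℕ → ℝ) =>
      (p.1.2, p.2, branches p.1.1)) (by fun_prop)
  -- Mecke's formula, after moving the distinguished child to the front.
  have mecke : ∀ (o x : Word) (a b : ℕ → Word), (∀ i, relabel (moveToFront i) (a i) = o) →
      (∀ i, relabel (moveToFront i) (b i) = x) →
      ∫⁻ g, ∑' i : ℕ, F (edgeLengths g) (a i) (b i) ∂gapLaw =
        ∫⁻ y, ∫⁻ t in Set.Ici 0, ∫⁻ z, F (ofLengths (merge t z (branches y))) o x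
          ∂gapLaw ∂volume ∂gapLaw := by
    intro o x a b ha hb
    have h := lintegral_tsum_pos_remove gapLaw (hH o x)
    rw [← map_branches_gapLaw, lintegral_map _ measurable_branches,
      lintegral_map _ measurable_branches] at h
    · rw [← h]
      refine lintegral_congr fun g => tsum_congr fun i => ?_
      rw [← hiso _ _ _ (ofLengths_merge_relabel g i), ha, hb]
    · exact Measurable.lintegral_prod_right' (f := fun p : (ℕ → ℝ × (Word × ℕ → ℝ)) × ℝ =>
        ∫⁻ z, F (ofLengths (merge p.2 z p.1)) o x ∂gapLaw) (Measurable.lintegral_prod_right'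
        (f := fun p : ((ℕ → ℝ × (Word × ℕ → ℝ)) × ℝ) × (Word × ℕ → ℝ) =>
          F (ofLengths (merge p.1.2 p.2 p.1.1)) o x)
        ((hH o x).comp (f := fun p : ((ℕ → ℝ × (Word × ℕ → ℝ)) × ℝ) × (Word × ℕ → ℝ) =>
          (p.1.2, p.2, p.1.1)) (by fun_prop)))
    · exact Measurable.tsum fun i => (hH o x).comp
        (f := fun s : ℕ → ℝ × (Word × ℕ → ℝ) => (pos s i, (s i).2, remove i s)) (by fun_prop)
  have hmove : ∀ i, relabel (moveToFront i) [i] = [0] := fun i => by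
    change relabelWord _ ([] ++ [i]) = _
    rw [relabelWord_append]
    simp [moveToFront]
  rw [mecke [] [0] (fun _ => []) (fun i => [i]) (fun _ => rfl) hmove,
    mecke [0] [] (fun i => [i]) (fun _ => []) hmove (fun _ => rfl)]
  have hswap : ∀ t y z, F (ofLengths (merge t z (branches y))) [] [0] =
      F (ofLengths (merge t y (branches z))) [0] [] := fun t y z => by
    rw [← hiso swap _ _ (ofLengths_merge_swap t z y)]
    rfl
  simp only [hswap]
  -- Both iterated integrals are equal by Tonelli's theorem.
  have hHb' : Measurable fun p : ((Word × ℕ → ℝ) × ℝ) × (Word × ℕ → ℝ) =>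
      F (ofLengths (merge p.1.2 p.1.1 (branches p.2))) [0] [] :=
    (hHb [0] []).comp (f := fun p : ((Word × ℕ → ℝ) × ℝ) × (Word × ℕ → ℝ) =>
      ((p.2, p.1.2), p.1.1)) (by fun_prop)
  conv_lhs => rw [lintegral_lintegral_swap hHb'.lintegral_prod_right'.aemeasurable]
  conv_rhs => rw [lintegral_lintegral_swap (hHb [0] []).lintegral_prod_right'.aemeasurable]
  refine lintegral_congr fun t => ?_
  rw [lintegral_lintegral_swap]
  exact ((hHb [0] []).comp (f := fun p : (Word × ℕ → ℝ) × (Word × ℕ → ℝ) =>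
    ((p.2, t), p.1)) (by fun_prop)).aemeasurable

/-! ### Existence of the message process -/

/-- `messUpper` satisfies the recursion at the root of almost every tree. The tree is written as a
subtree of a larger one, in which the recursion for `upper` applies. -/
theorem ae_isLeast_messUpper : ∀ᵐ g ∂gapLaw,
    IsLeast (Set.range fun i => max (pos (branches (subtree [0] g)) i -
      messUpper (branches (subtree [0] g) i).2) 0) (messUpper (subtree [0] g)) := by
  filter_upwards [ae_isSolution_upper] with g hg
  have h := hg (down [] 0)
  rw [upper_down] at h
  convert! h using 1
  have hr : ∀ i, reduced (edgeLengths g) (upper (edgeLengths g)) (down [0] i) =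
      max (pos (branches (subtree [0] g)) i - messUpper (branches (subtree [0] g) i).2) 0 := by
    intro i
    rw [reduced, edgeLengths_und_down, lengths_eq_pos, upper_down, branches, subtree_subtree]
    rfl
  ext y
  constructor
  · rintro ⟨i, rfl⟩
    exact ⟨down [0] i, mem_next_down.2 ⟨i, rfl⟩, hr i⟩
  · rintro ⟨d, hd, rfl⟩
    obtain ⟨i, rfl⟩ := mem_next_down.1 hd
    exact ⟨i, (hr i).symm⟩

theorem lambertW_one_eq {m : ℝ} (h0 : 0 ≤ m) (hm : m = Real.exp (-m)) : lambertW 1 = m := by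
  have h1 : m * Real.exp m = 1 := by
    nth_rewrite 1 [hm]
    rw [← Real.exp_add, neg_add_cancel, Real.exp_zero]
  have hex : ∃ a ∈ Set.Ici (0 : ℝ), (fun x => x * Real.exp x) a = 1 := ⟨m, h0, h1⟩
  have hw0 : 0 ≤ lambertW 1 := Function.invFunOn_mem hex
  have hw1 : lambertW 1 * Real.exp (lambertW 1) = 1 := Function.invFunOn_eq hex
  have key : ∀ a b : ℝ, 0 ≤ a → a < b → a * Real.exp a < b * Real.exp b := fun a b ha hab =>
    mul_lt_mul'' hab (Real.exp_lt_exp.2 hab) ha (Real.exp_pos _).le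
  rcases lt_trichotomy (lambertW 1) m with h | h | h
  · exact absurd (key _ _ hw0 h) (by rw [h1, hw1]; exact lt_irrefl _)
  · exact h
  · exact absurd (key _ _ h0 h) (by rw [h1, hw1]; exact lt_irrefl _)

/-- The mean of the limiting message is the fixed point of `x ↦ exp (-x)`. -/
theorem toReal_lintegral_messUpper :
    (∫⁻ g, ENNReal.ofReal (messUpper g) ∂gapLaw).toReal =
      Real.exp (-(∫⁻ g, ENNReal.ofReal (messUpper g) ∂gapLaw).toReal) := by
  have h := lintegral_shiftedMin gapLaw measurable_messUpper messUpper_nonneg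
    lintegral_messUpper_ne_top
  have hm : Measurable fun s => ENNReal.ofReal (shiftedMin messUpper s) :=
    (measurable_shiftedMin measurable_messUpper).ennreal_ofReal
  have hm' : Measurable fun g => ENNReal.ofReal (shiftedMin messUpper (branches g)) :=
    hm.comp measurable_branches
  rw [← map_branches_gapLaw, lintegral_map hm (by fun_prop)] at h
  have h2 : ∫⁻ g, ENNReal.ofReal (messUpper g) ∂gapLaw =
      ∫⁻ g, ENNReal.ofReal (shiftedMin messUpper (branches g)) ∂gapLaw := by
    rw [← map_subtree_gapLaw [0], lintegral_map (by fun_prop) (by fun_prop),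
      lintegral_map hm' (by fun_prop)]
    refine lintegral_congr_ae ?_
    filter_upwards [ae_isLeast_messUpper] with g hg
    rw [← hg.csInf_eq]
    rfl
  rw [h] at h2
  conv_lhs => rw [h2]
  exact ENNReal.toReal_ofReal (Real.exp_pos _).le

theorem measure_lt_messUpper (y : ℝ) :
    gapLaw {g | y < messUpper g} = ENNReal.ofReal (messageTail y) := by
  rw [messageTail]
  split_ifs with hy
  swap
  · rw [ENNReal.ofReal_one, ← measure_univ (μ := gapLaw)]
    congr 1
    exact Set.eq_univ_of_forall fun g => (not_le.1 hy).trans_le (messUpper_nonneg g)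
  have h := measure_forall_lt_sub gapLaw measurable_messUpper messUpper_nonneg
    lintegral_messUpper_ne_top hy
  rw [← toReal_lintegral_messUpper,
    ← lambertW_one_eq ENNReal.toReal_nonneg toReal_lintegral_messUpper] at h
  rw [← h]
  have hs : MeasurableSet {s : ℕ → ℝ × (Word × ℕ → ℝ) |
      ∀ i, y < pos s i - messUpper (s i).2} := by
    simp only [Set.ofPred_forall]
    exact MeasurableSet.iInter fun i => measurableSet_lt measurable_const (by fun_prop)
  have hs' := hs.preimage measurable_branches
  rw [← map_branches_gapLaw, Measure.map_apply measurable_branches hs]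
  rw [← map_subtree_gapLaw [0], Measure.map_apply (by fun_prop) hs',
    Measure.map_apply (by fun_prop) (measurableSet_lt measurable_const measurable_messUpper)]
  refine measure_congr ?_
  filter_upwards [ae_isLeast_messUpper] with g hg
  refine propext ?_
  change y < messUpper (subtree [0] g) ↔ ∀ i, y < pos (branches (subtree [0] g)) i -
    messUpper (branches (subtree [0] g) i).2
  constructor
  · intro hlt i
    exact (lt_max_iff.1 (hlt.trans_le (hg.2 ⟨i, rfl⟩))).resolve_right (not_lt.2 hy)
  · intro hlt
    obtain ⟨i, hi⟩ := hg.1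
    rw [← hi]
    exact lt_max_of_lt_left (hlt i)

theorem iIndepFun_subtree (d : ℕ) :
    iIndepFun (fun (p : {v : Word // v.length = d} × ℕ) g => subtree (p.2 :: p.1) g) gapLaw := by
  rw [iIndepFun_iff_map_fun_eq_infinitePi_map fun p => measurable_subtree _]
  simp only [map_subtree_gapLaw]
  refine map_gapLaw_of_injective (ι := {v : Word // v.length = d} × ℕ) (κ := Word × ℕ)
    (f := fun q => (q.2.1 ++ q.1.2 :: q.1.1, q.2.2)) ?_
  rintro ⟨⟨⟨v, hv⟩, i⟩, u, k⟩ ⟨⟨⟨w, hw⟩, j⟩, u', k'⟩ h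
  simp only [Prod.mk.injEq] at h
  obtain ⟨h, rfl⟩ := h
  obtain ⟨rfl, h'⟩ := List.append_inj' h (by simp [hv, hw])
  obtain ⟨rfl, rfl⟩ := List.cons.inj h'
  rfl

/-- The field of the gaps at the vertices of depth at most `d` is independent of the field at the
other vertices. -/
theorem indepFun_subtree_lengths (d : ℕ) :
    IndepFun (fun g (p : {v : Word // v.length = d} × ℕ) => subtree (p.2 :: p.1) g)
      (fun g (p : {v : Word // v.length ≤ d} × ℕ) => lengths g (p.1, p.2)) gapLaw := by
  have hind : iIndepFun (fun (p : Word × ℕ) (g : Word × ℕ → ℝ) => g p) gapLaw :=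
    iIndepFun_infinitePi (X := fun _ x => x) fun _ => measurable_id
  set m : Word × ℕ → MeasurableSpace (Word × ℕ → ℝ) := fun p =>
    MeasurableSpace.comap (fun g => g p) inferInstance
  have hcoord : ∀ (A : Set (Word × ℕ)) (p : Word × ℕ), p ∈ A →
      Measurable[⨆ q ∈ A, m q] fun g : Word × ℕ → ℝ => g p := fun A p hp =>
    (comap_measurable _).mono (le_iSup₂_of_le p hp le_rfl) le_rfl
  have h := indep_iSup_of_disjoint (S := {p : Word × ℕ | d < p.1.length})
    (T := {p | p.1.length ≤ d}) (m := m) (fun p => (measurable_pi_apply p).comap_le) hind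
    (Set.disjoint_left.2 fun p (hp : d < p.1.length) (hp' : p.1.length ≤ d) =>
      absurd hp (not_lt.2 hp'))
  rw [IndepFun_iff_Indep]
  refine indep_of_indep_of_le_left (indep_of_indep_of_le_right h ?_) ?_
  · refine Measurable.comap_le ?_
    refine @measurable_pi_lambda _ _ _ (_) _ _ fun p => ?_
    exact @Finset.measurable_fun_sum _ _ _ _ _ _ (_) _ _ fun k _ => hcoord _ (p.1.1, k) p.1.2
  · refine Measurable.comap_le ?_
    refine @measurable_pi_lambda _ _ _ (_) _ _ fun p => ?_
    refine @measurable_pi_lambda _ _ _ (_) _ _ fun q => ?_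
    refine hcoord _ (q.1 ++ p.2 :: p.1.1, q.2) ?_
    have := p.1.2
    simp only [Set.mem_ofPred_eq, List.length_append, List.length_cons]
    omega

theorem isMessageProcess_upper :
    IsMessageProcess gapLaw edgeLengths fun g => upper (edgeLengths g) where
  pwit := isPWIT_edgeLengths
  measurable := measurable_pi_lambda _ fun d => (measurable_upper d).comp measurable_edgeLengths
  recursion := ae_isSolution_upper
  law v i y := by
    simp only [upper_down]
    rw [← measure_lt_messUpper]
    conv_rhs => rw [← map_subtree_gapLaw (i :: v)]
    rw [Measure.map_apply (by fun_prop) (measurableSet_lt measurable_const measurable_messUpper)]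
    rfl
  indep_level d := by
    simp only [upper_down]
    exact (iIndepFun_subtree d).comp (fun _ => messUpper) fun _ => measurable_messUpper
  indep_lengths d := by
    simp only [upper_down, edgeLengths_und_down]
    have hφ : Measurable fun (x : {v : Word // v.length = d} × ℕ → Word × ℕ → ℝ) p =>
        messUpper (x p) :=
      measurable_pi_lambda _ fun p => measurable_messUpper.comp (measurable_pi_apply p)
    exact (indepFun_subtree_lengths d).comp hφ measurable_id

/-! ### Involution invariance of the optimal cover -/

theorem measurable_optCover_upper : Measurable fun ℓ : Edge → ℝ => optCover ℓ (upper ℓ) :=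
  measurable_optCover.comp (measurable_id.prodMk (measurable_pi_lambda _ measurable_upper))

theorem IsMessageProcess.ae_eq_upper {Ω : Type*} [MeasurableSpace Ω] {P : Measure Ω}
    {ξ : Ω → Edge → ℝ} {X : Ω → DirEdge → ℝ} (h : IsMessageProcess P ξ X) :
    ∀ᵐ ω ∂P, X ω = upper (ξ ω) := by
  filter_upwards [h.recursion, h.pwit.ae_isSolution_iff] with ω h1 h2
  exact (h2 _).1 h1

theorem IsMessageProcess.isInvolutionInvariantEdgeCover {Ω : Type*} [MeasurableSpace Ω]
    {P : Measure Ω} {ξ : Ω → Edge → ℝ} {X : Ω → DirEdge → ℝ} (h : IsMessageProcess P ξ X) :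
    IsInvolutionInvariantEdgeCover P ξ fun ω => optCover (ξ ω) (X ω) where
  pwit := h.pwit
  measurable := measurable_optCover.comp (h.pwit.measurable.prodMk h.measurable)
  covers := by
    filter_upwards [h.recursion] with ω hω
    exact IsSolution.covers hω
  involution f hf := by
    set F : (Edge → ℝ) → Word → Word → ℝ≥0∞ := fun ℓ o x => f ℓ (optCover ℓ (upper ℓ)) o x
    have hF : ∀ o x, Measurable fun ℓ => F ℓ o x := fun o x =>
      (hf.measurable o x).comp (measurable_id.prodMk measurable_optCover_upper)
    have hiso : ∀ (γ : tree ≃g tree) (ℓ ℓ' : Edge → ℝ), (∀ e, ℓ' (γ.mapEdgeSet e) = ℓ e) →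
        ∀ o x, F ℓ' (γ o) (γ x) = F ℓ o x := fun γ ℓ ℓ' hℓ =>
      hf.iso γ ℓ ℓ' _ _ hℓ (mapEdgeSet_mem_optCover hℓ)
    have hl : ∀ a b : ℕ → Word, ∫⁻ ω, ∑' i : ℕ, f (ξ ω) (optCover (ξ ω) (X ω)) (a i) (b i) ∂P =
        ∫⁻ g, ∑' i : ℕ, F (edgeLengths g) (a i) (b i) ∂gapLaw := by
      intro a b
      rw [← h.pwit.lintegral_eq (F := fun ℓ => ∑' i : ℕ, F ℓ (a i) (b i))
        (Measurable.tsum fun i => hF _ _)]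
      refine lintegral_congr_ae ?_
      filter_upwards [h.ae_eq_upper] with ω hω
      simp only [hω, F]
    have h1 : ∀ ω, ∑' x : tree.neighborSet [], f (ξ ω) (optCover (ξ ω) (X ω)) [] x =
        ∑' i : ℕ, f (ξ ω) (optCover (ξ ω) (X ω)) [] [i] := fun ω => tsum_neighborSet_root _
    have h2 : ∀ ω, ∑' x : tree.neighborSet [], f (ξ ω) (optCover (ξ ω) (X ω)) x [] =
        ∑' i : ℕ, f (ξ ω) (optCover (ξ ω) (X ω)) [i] [] := fun ω =>
      tsum_neighborSet_root fun v => f (ξ ω) (optCover (ξ ω) (X ω)) v []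
    simp only [h1, h2]
    rw [hl, hl]
    exact lintegral_gapLaw_involution hF hiso

/-! ### Splitting the edge lengths between the endpoints -/

/-- The part of the length of the edge `d` that is charged to the first endpoint of `d`. The length
is split evenly after a correction by the messages along the edge, and the result is truncated to
lie between zero and the length. -/
def share (ℓ : Edge → ℝ) (d : DirEdge) : ℝ :=
  max 0 (min (ℓ (und d)) ((ℓ (und d) - upper ℓ d + upper ℓ d.symm) / 2))

theorem share_nonneg (ℓ : Edge → ℝ) (d : DirEdge) : 0 ≤ share ℓ d := le_max_left _ _

theorem share_add_share_symm {ℓ : Edge → ℝ} {d : DirEdge} (h : 0 ≤ ℓ (und d)) :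
    share ℓ d + share ℓ d.symm = ℓ (und d) := by
  simp only [share, und_symm, SimpleGraph.Dart.symm_symm]
  rcases le_total (ℓ (und d)) ((ℓ (und d) - upper ℓ d + upper ℓ d.symm) / 2) with h1 | h1
  · rw [min_eq_left h1, max_eq_right h, max_eq_left ((min_le_right _ _).trans (by linarith)),
      add_zero]
  rcases le_total 0 ((ℓ (und d) - upper ℓ d + upper ℓ d.symm) / 2) with h2 | h2
  · rw [min_eq_right h1, max_eq_right h2, min_eq_right (by linarith), max_eq_right (by linarith)]
    ring
  · rw [min_eq_right h1, max_eq_left h2, min_eq_left (by linarith), max_eq_right h, zero_add]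

open Classical in
/-- The part of the cost of the edge `{o, x}` in the network `(ℓ, c)` that is charged to `o`. -/
def shareCost (ℓ : Edge → ℝ) (c : Set Edge) (o x : Word) : ℝ≥0∞ :=
  if h : tree.Adj o x then
    if und ⟨(o, x), h⟩ ∈ c then ENNReal.ofReal (share ℓ ⟨(o, x), h⟩) else 0
  else 0

open Classical in
theorem shareCost_dir (ℓ : Edge → ℝ) (c : Set Edge) (d : DirEdge) :
    shareCost ℓ c d.fst d.snd = if und d ∈ c then ENNReal.ofReal (share ℓ d) else 0 :=
  dif_pos d.adj

@[fun_prop]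
theorem measurable_share (d : DirEdge) : Measurable fun ℓ : Edge → ℝ => share ℓ d := by
  unfold share
  fun_prop

theorem isNetworkFunction_shareCost : IsNetworkFunction shareCost where
  measurable o x := by
    classical
    by_cases h : tree.Adj o x
    · simp only [shareCost, dif_pos h]
      refine Measurable.ite ?_ (by fun_prop) measurable_const
      exact measurableSet_setOfPred.2 ((measurable_set_mem _).comp measurable_snd)
    · simp only [shareCost, dif_neg h]
      exact measurable_const
  iso γ ℓ ℓ' c c' hℓ hc o x := by
    classical
    by_cases h : tree.Adj o x
    · set d : DirEdge := ⟨(o, x), h⟩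
      have hs : share ℓ' (mapDir γ d) = share ℓ d := by
        have hsym : (mapDir γ d).symm = mapDir γ d.symm := rfl
        rw [share, share, hsym, upper_mapDir hℓ, upper_mapDir hℓ, und_mapDir, hℓ]
      have h1 := shareCost_dir ℓ' c' (mapDir γ d)
      have h2 := shareCost_dir ℓ c d
      rw [hs, und_mapDir, hc, ← h2] at h1
      exact h1
    · rw [shareCost, shareCost, dif_neg h, dif_neg (by rwa [γ.map_adj_iff])]

/-- The part of the cost of the network `(ℓ, c)` that is charged to the root. -/
def rootShare (ℓ : Edge → ℝ) (c : Set Edge) : ℝ≥0∞ := ∑' i : ℕ, shareCost ℓ c [] [i]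

open Classical in
theorem tsum_root_eq (c : Set Edge) (f : Edge → ℝ≥0∞) :
    ∑' d : {d : DirEdge // d.fst = [] ∧ und d ∈ c}, f (und d) =
      ∑' i : ℕ, if und (down [] i) ∈ c then f (und (down [] i)) else 0 := by
  have h := tsum_subtype {i : ℕ | und (down [] i) ∈ c} fun i => f (und (down [] i))
  simp only [Set.indicator, Set.mem_ofPred_eq] at h
  rw [← h]
  refine (Equiv.tsum_eq (Equiv.ofBijective
    (fun i : {i : ℕ | und (down [] i) ∈ c} => (⟨down [] i, rfl, i.2⟩ :
      {d : DirEdge // d.fst = [] ∧ und d ∈ c})) ⟨?_, ?_⟩) fun d => f (und d)).symm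
  · intro i j hij
    have := congrArg (fun d : {d : DirEdge // d.fst = [] ∧ und d ∈ c} => d.1.snd) hij
    exact Subtype.ext (List.cons.inj this).1
  · rintro ⟨d, hd, hc⟩
    obtain ⟨v, i, rfl | rfl⟩ := eq_down_or_eq_symm_down d
    · obtain rfl : v = [] := hd
      exact ⟨⟨i, hc⟩, rfl⟩
    · exact absurd hd (List.cons_ne_nil _ _)

theorem IsPWIT.ae_length_nonneg {Ω : Type*} [MeasurableSpace Ω] {P : Measure Ω}
    {ξ : Ω → Edge → ℝ} (h : IsPWIT P ξ) : ∀ᵐ ω ∂P, ∀ i, 0 ≤ ξ ω (und (down [] i)) := by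
  refine h.ae (p := fun ℓ => ∀ i, 0 ≤ ℓ (und (down [] i))) ?_
  filter_upwards [ae_branches (ae_gap_nonneg gapLaw)] with g hg i
  rw [edgeLengths_und_down]
  exact Finset.sum_nonneg fun j _ => hg j

/-- Since the two endpoints of the edges play symmetric roles in an involution invariant cover, the
root pays on average half of the cost of the edges that cover it. -/
theorem IsInvolutionInvariantEdgeCover.expectedRootCost_eq {Ω : Type*} [MeasurableSpace Ω]
    {P : Measure Ω} {ξ : Ω → Edge → ℝ} {C : Ω → Set Edge}
    (h : IsInvolutionInvariantEdgeCover P ξ C) :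
    expectedRootCost P ξ C = 2 * ∫⁻ ω, rootShare (ξ ω) (C ω) ∂P := by
  classical
  have hm : ∀ o x, Measurable fun ω => shareCost (ξ ω) (C ω) o x := fun o x =>
    (isNetworkFunction_shareCost.measurable o x).comp (h.pwit.measurable.prodMk h.measurable)
  have hinv := h.involution shareCost isNetworkFunction_shareCost
  have h1 : ∀ ω, ∑' x : tree.neighborSet [], shareCost (ξ ω) (C ω) [] x =
      rootShare (ξ ω) (C ω) := fun ω => tsum_neighborSet_root _
  have h2 : ∀ ω, ∑' x : tree.neighborSet [], shareCost (ξ ω) (C ω) x [] =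
      ∑' i : ℕ, shareCost (ξ ω) (C ω) [i] [] := fun ω =>
    tsum_neighborSet_root fun v => shareCost (ξ ω) (C ω) v []
  simp only [h1, h2] at hinv
  have hroot : Measurable fun ω => rootShare (ξ ω) (C ω) := Measurable.tsum fun i => hm _ _
  calc expectedRootCost P ξ C
      = ∫⁻ ω, (rootShare (ξ ω) (C ω) + ∑' i : ℕ, shareCost (ξ ω) (C ω) [i] []) ∂P := by
        refine lintegral_congr_ae ?_
        filter_upwards [h.pwit.ae_length_nonneg] with ω hω
        rw [tsum_root_eq (C ω) fun e => ENNReal.ofReal (ξ ω e), rootShare, ← ENNReal.tsum_add]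
        refine tsum_congr fun i => ?_
        have hd := shareCost_dir (ξ ω) (C ω) (down [] i)
        have hs := shareCost_dir (ξ ω) (C ω) (down [] i).symm
        rw [und_symm] at hs
        refine Eq.trans ?_ (congrArg₂ (· + ·) hd hs).symm
        split_ifs
        · rw [← ENNReal.ofReal_add (share_nonneg _ _) (share_nonneg _ _),
            share_add_share_symm (hω i)]
        · rw [add_zero]
    _ = 2 * ∫⁻ ω, rootShare (ξ ω) (C ω) ∂P := by
        rw [lintegral_add_left hroot, ← hinv, two_mul]

/-! ### The optimal cover minimizes the share of the root -/

/-- Among all edge covers, the optimal one minimizes the cost charged to the root. -/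
theorem rootShare_optCover_le {ℓ : Edge → ℝ} (hsol : IsSolution ℓ (upper ℓ))
    (hinj : ∀ i j, i ≠ j → ℓ (und (down [] i)) - upper ℓ (down [] i) ≠
      ℓ (und (down [] j)) - upper ℓ (down [] j))
    {c : Set Edge} (hc : Covers c) :
    rootShare ℓ (optCover ℓ (upper ℓ)) ≤ rootShare ℓ c := by
  classical
  set z : ℕ → ℝ := fun i => ℓ (und (down [] i)) - upper ℓ (down [] i) with hz
  set b : ℕ → ℝ := fun i => upper ℓ (down [] i).symm with hb
  have hshare : ∀ i, share ℓ (down [] i) =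
      max 0 (min (ℓ (und (down [] i))) ((z i + b i) / 2)) := fun i => rfl
  have hb0 : ∀ i, 0 ≤ b i := fun i => upper_nonneg _
  have hzl : ∀ i, z i ≤ ℓ (und (down [] i)) := fun i => sub_le_self _ (upper_nonneg _)
  -- `b i` is the minimum of the positive parts of the `z j` with `j ≠ i`.
  have hble : ∀ i j, j ≠ i → b i ≤ max (z j) 0 := fun i j hij =>
    (hsol (down [] i).symm).2 ⟨down [] j, ⟨rfl, fun h => hij (List.cons.inj h).1⟩, rfl⟩
  have hbmem : ∀ i, ∃ j, j ≠ i ∧ b i = max (z j) 0 := by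
    intro i
    obtain ⟨d, ⟨hd1, hd2⟩, hd⟩ := (hsol (down [] i).symm).1
    obtain ⟨v, j, rfl | rfl⟩ := eq_down_or_eq_symm_down d
    · obtain rfl : v = [] := hd1
      exact ⟨j, fun h => hd2 (by rw [h]; rfl), hd.symm⟩
    · exact absurd hd1 (List.cons_ne_nil _ _)
  have hmem : ∀ i, und (down [] i) ∈ optCover ℓ (upper ℓ) ↔ z i ≤ b i := fun i => by
    rw [hsol.und_mem_optCover_iff, hz, hb]
    exact sub_le_iff_le_add'.symm
  have hcost : ∀ (c : Set Edge) i, shareCost ℓ c [] [i] =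
      if und (down [] i) ∈ c then ENNReal.ofReal (share ℓ (down [] i)) else 0 := fun c i =>
    shareCost_dir ℓ c (down [] i)
  by_cases h0 : ∀ i, z i ≤ b i → z i + b i ≤ 0
  · -- In this case, no edge of the optimal cover is charged to the root.
    refine le_trans (le_of_eq ?_) zero_le
    refine ENNReal.tsum_eq_zero.2 fun i => ?_
    rw [hcost]
    split_ifs with hi
    · rw [hmem] at hi
      rw [hshare, max_eq_left ((min_le_right _ _).trans (by linarith [h0 i hi]))]
      exact ENNReal.ofReal_zero
    · rfl
  push Not at h0
  obtain ⟨i₀, hi₀, hi₀pos⟩ := h0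
  -- Otherwise, exactly one edge of the optimal cover is incident with the root.
  have huniq : ∀ j, j ≠ i₀ → b j < z j := by
    intro j hj
    by_contra! hle
    have h1 := hble j i₀ hj.symm
    have h2 := hble i₀ j hj
    have h3 := hinj i₀ j hj.symm
    change z i₀ ≠ z j at h3
    rcases le_total (z i₀) 0 with hn | hn
    · rw [max_eq_right hn] at h1
      rw [max_eq_right (by linarith)] at h2
      linarith
    · rw [max_eq_left hn] at h1
      rcases le_total (z j) 0 with hm | hm
      · rw [max_eq_right hm] at h2
        linarith
      · rw [max_eq_left hm] at h2
        exact h3 (by linarith)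
  have hopt : rootShare ℓ (optCover ℓ (upper ℓ)) = ENNReal.ofReal (share ℓ (down [] i₀)) := by
    rw [rootShare, tsum_eq_single i₀]
    · rw [hcost, if_pos ((hmem i₀).2 hi₀)]
    · intro j hj
      rw [hcost, if_neg]
      rw [hmem, not_le]
      exact huniq j hj
  rw [hopt]
  obtain ⟨d, hd, hdc⟩ := hc []
  obtain ⟨v, k, rfl | rfl⟩ := eq_down_or_eq_symm_down d
  swap
  · exact absurd hd (List.cons_ne_nil _ _)
  obtain rfl : v = [] := hd
  refine le_trans ?_ (ENNReal.le_tsum k)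
  rw [hcost, if_pos hdc]
  refine ENNReal.ofReal_le_ofReal ?_
  by_cases hk : k = i₀
  · rw [hk]
  have h1 := hble i₀ k hk
  have h2 : z i₀ ≤ b k := by
    obtain ⟨j, hj, hjb⟩ := hbmem k
    rw [hjb]
    by_cases hji : j = i₀
    · rw [hji]; exact le_max_left _ _
    · exact hi₀.trans (hble i₀ j hji)
  have hzk : 0 < z k := (hb0 k).trans_lt (huniq k hk)
  rw [max_eq_left hzk.le] at h1
  rw [hshare, hshare]
  refine max_le_max le_rfl ?_
  refine le_min ?_ ?_
  · exact (min_le_right _ _).trans (by linarith [hzl k])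
  · exact (min_le_right _ _).trans (by linarith)

theorem expectedRootCost_optCover_le {Ω : Type*} [MeasurableSpace Ω] {P : Measure Ω}
    {ξ : Ω → Edge → ℝ} {X : Ω → DirEdge → ℝ} (h : IsMessageProcess P ξ X)
    {Ω' : Type*} [MeasurableSpace Ω'] {P' : Measure Ω'} {ξ' : Ω' → Edge → ℝ}
    {C : Ω' → Set Edge} (hC : IsInvolutionInvariantEdgeCover P' ξ' C) :
    expectedRootCost P ξ (fun ω => optCover (ξ ω) (X ω)) ≤ expectedRootCost P' ξ' C := by
  have hm : Measurable fun ℓ : Edge → ℝ => rootShare ℓ (optCover ℓ (upper ℓ)) :=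
    Measurable.tsum fun i => (isNetworkFunction_shareCost.measurable _ _).comp
      (measurable_id.prodMk measurable_optCover_upper)
  have hP : ∫⁻ ω, rootShare (ξ ω) (optCover (ξ ω) (X ω)) ∂P =
      ∫⁻ ω, rootShare (ξ' ω) (optCover (ξ' ω) (upper (ξ' ω))) ∂P' := by
    rw [hC.pwit.lintegral_eq hm, ← h.pwit.lintegral_eq hm]
    refine lintegral_congr_ae ?_
    filter_upwards [h.ae_eq_upper] with ω hω
    rw [hω]
  have hinj : ∀ᵐ ω ∂P', ∀ i j, i ≠ j → ξ' ω (und (down [] i)) - upper (ξ' ω) (down [] i) ≠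
      ξ' ω (und (down [] j)) - upper (ξ' ω) (down [] j) := by
    refine hC.pwit.ae (p := fun ℓ => ∀ i j, i ≠ j → ℓ (und (down [] i)) - upper ℓ (down [] i) ≠
      ℓ (und (down [] j)) - upper ℓ (down [] j)) ?_
    filter_upwards [ae_branches (ae_injective_pos_sub gapLaw measurable_messUpper)]
      with g hg i j hij
    simp only [edgeLengths_und_down, upper_down]
    exact hg i j hij
  rw [h.isInvolutionInvariantEdgeCover.expectedRootCost_eq, hC.expectedRootCost_eq, hP]
  refine mul_le_mul_right (lintegral_mono_ae ?_) 2
  filter_upwards [hC.pwit.ae_isSolution_iff, hinj, hC.covers] with ω h1 h2 h3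
  exact rootShare_optCover_le ((h1 _).2 rfl) h2 h3

end PWIT

end

theorem mainTheorem4 :
    (∃ (Ω : Type) (_ : MeasurableSpace Ω) (P : Measure Ω)
      (ξ : Ω → PWIT.Edge → ℝ) (X : Ω → PWIT.DirEdge → ℝ),
      IsProbabilityMeasure P ∧ PWIT.IsMessageProcess P ξ X) ∧
    ∀ (Ω : Type*) [MeasurableSpace Ω] (P : Measure Ω) [IsProbabilityMeasure P]
      (ξ : Ω → PWIT.Edge → ℝ) (X : Ω → PWIT.DirEdge → ℝ), PWIT.IsMessageProcess P ξ X →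
      PWIT.IsInvolutionInvariantEdgeCover P ξ (fun ω => PWIT.optCover (ξ ω) (X ω)) ∧
      ∀ (Ω' : Type*) [MeasurableSpace Ω'] (P' : Measure Ω') [IsProbabilityMeasure P']
        (ξ' : Ω' → PWIT.Edge → ℝ) (C : Ω' → Set PWIT.Edge),
        PWIT.IsInvolutionInvariantEdgeCover P' ξ' C →
        PWIT.expectedRootCost P ξ (fun ω => PWIT.optCover (ξ ω) (X ω)) ≤
          PWIT.expectedRootCost P' ξ' C := by
  refine ⟨⟨_, _, PWIT.gapLaw, PWIT.edgeLengths, _, inferInstance, PWIT.isMessageProcess_upper⟩, ?_⟩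
  intro Ω _ P _ ξ X h
  refine ⟨h.isInvolutionInvariantEdgeCover, ?_⟩
  intro Ω' _ P' _ ξ' C hC
  exact PWIT.expectedRootCost_optCover_le h hC
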